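/- **Theorem 3.40.** A multi-index of weight $m\ge 1$ is a finite sequence $\alpha=(\alpha_1,\dots,\alpha_s)$ of positive integers with $\alpha_1+\dots+\alpha_s=m$. It is determined by the set $\mathcal S_m(\alpha)=\{\alpha_1,\alpha_1+\alpha_2,\dots,\alpha_1+\dots+\alpha_{s-1}\}\subseteq\{1,\dots,m-1\}$. Let $\alpha^*=(\alpha^*_1,\dots,\alpha^*_t)$ be the multi-index of weight $m$ with $\mathcal S_m(\alpha^*)=\{1,\dots,m-1\}\setminus\mathcal S_m(\alpha)$, and let $\alpha^{\backprime}=(\alpha^*_t,\dots,\alpha^*_1)$ be its reversal. For $n\in\mathbb N=\{0,1,2,\dots\}$ put $$S_\alpha(n)=\sum_{n>n_1\ge\cdots\ge n_s\ge 0}\frac{1}{(n_1+1)^{\alpha_1}\cdots(n_s+1)^{\alpha_s}} .$$ For a sequence $a:\mathbb N\to\mathbb C$ put $(\Delta a)(n)=a(n)-a(n+1)$ and $(\nabla a)(n)=(\Delta^n a)(0)$. The Newton series interpolating $S_\alpha$ is $$F_\alpha(z)=\sum_{n=0}^\infty(-1)^n(\nabla S_\alpha)(n)\binom zn,\qquad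 \binom zn=\frac{z(z-1)\cdots(z-n+1)}{n!}.$$ For a multi-index $\beta=(\beta_1,\dots,\beta_r)$ put $$G_\beta(z)=\sum\left(\frac1{n_{1,1}}-\frac1{n_{1,1}+z}\right)\frac1{n_{1,2}\cdots n_{1,\beta_1}}\ \prod_{j=2}^{r}\frac{1}{(n_{j,1}+z)\,n_{j,2}\cdots n_{j,\beta_j}},$$ where the sum is over all positive integers $n_{j,i}$ $(1\le j\le r,\ 1\le i\le\beta_j)$ such that $n_{j,1}>\cdots>n_{j,\beta_j}$ for every $j$ and $n_{j,\beta_j}\ge n_{j+1,1}$ for $1\le j<r$. Then, for every multi-index $\alpha$, the abscissa of convergence of $F_\alpha$ is $-\alpha_1^*$; that is, the series $F_\alpha(z)$ converges whenever $\operatorname{Re}z>-\alpha_1^*$, and diverges whenever $\operatorname{Re}z<-\alpha_1^*$ and $z\notin\mathbb N$. Moreover, for every $z\in\mathbb C$ with $\operatorname{Re}z>-\alpha_1^*$, the multiple series $G_{\alpha^{\backprime}}(z)$ converges absolutely and $$F_\alpha(z)=G_{\alpha^{\backprime}}(z).$$ -/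

import Mathlib

open Filter Topology

/-! A multi-index of weight `m` (a finite sequence of positive integers with sum `m`, where
`0 < m`) is a `Composition m`. The equivalence `compositionEquiv` followed by
`compositionAsSetEquiv` sends `(α₁, …, αₛ)` to the set of its proper partial sums
`α₁, α₁ + α₂, …, α₁ + ⋯ + αₛ₋₁`; the number `p ∈ {1, …, m - 1}` is represented by the
element `p - 1` of `Fin (m - 1)`. -/

/-- The bijection between multi-indices of weight `m` and subsets of `{1, …, m - 1}`. -/
def multiIndexEquiv (m : ℕ) : Composition m ≃ Finset (Fin (m - 1)) :=
  (compositionEquiv m).trans (compositionAsSetEquiv m)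

/-- The dual `α*`: the multi-index whose set of partial sums is the complement of that of `α`. -/
def hoffmanDual {m : ℕ} (α : Composition m) : Composition m :=
  (multiIndexEquiv m).symm (multiIndexEquiv m α)ᶜ

/-- The reversed dual `(α*)^τ`. -/
def reversedDual {m : ℕ} (α : Composition m) : Composition m :=
  (hoffmanDual α).reverse

open Classical in
/-- The finite multiple harmonic sum
`∑_{n > n₁ ≥ ⋯ ≥ nₛ ≥ 0} 1 / ((n₁ + 1)^α₁ ⋯ (nₛ + 1)^αₛ)`. -/
noncomputable def harmonicSum {m : ℕ} (α : Composition m) (n : ℕ) : ℂ :=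
  ∑ k : Fin α.length → Fin n with Antitone k,
    ∏ i, 1 / (((k i : ℕ) : ℂ) + 1) ^ α.blocksFun i

/-- The difference operator `(Δ a)(n) = a(n) - a(n + 1)`. -/
def diffOp (a : ℕ → ℂ) : ℕ → ℂ := fun n => a n - a (n + 1)

/-- The inversion operator `(∇ a)(n) = (Δⁿ a)(0)`. -/
def invOp (a : ℕ → ℂ) : ℕ → ℂ := fun n => (diffOp^[n] a) 0

/-- The binomial coefficient `z (z - 1) ⋯ (z - n + 1) / n!`. -/
noncomputable def complexBinom (z : ℂ) (n : ℕ) : ℂ :=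
  (∏ i ∈ Finset.range n, (z - i)) / (n.factorial : ℂ)

/-- The partial sum, over `n < N`, of the Newton series `∑ (-1)ⁿ (∇ a)(n) binom(z, n)`
interpolating the sequence `a`. -/
noncomputable def newtonPartialSum (a : ℕ → ℂ) (z : ℂ) (N : ℕ) : ℂ :=
  ∑ n ∈ Finset.range N, (-1) ^ n * invOp a n * complexBinom z n

/-- The Newton series interpolating `a` converges at `z`, with sum `w`. -/
def HasNewtonSum (a : ℕ → ℂ) (z w : ℂ) : Prop :=
  Tendsto (newtonPartialSum a z) atTop (𝓝 w)

/-- `ρ` is the abscissa of convergence of the Newton series interpolating `a`: the series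
converges for `Re z > ρ`, and diverges for `Re z < ρ` unless `z` is a natural number. -/
def IsNewtonAbscissa (a : ℕ → ℂ) (ρ : EReal) : Prop :=
  (∀ z : ℂ, ρ < (z.re : EReal) → ∃ w, HasNewtonSum a z w) ∧
  (∀ z : ℂ, (z.re : EReal) < ρ → (∀ n : ℕ, z ≠ n) → ¬ ∃ w, HasNewtonSum a z w)

/-- `P_r(n₁, …, n_r; z) = 1 / ((n₁ + z) n₂ ⋯ n_r)` (the first index is `0 : Fin r`). -/
noncomputable def blockP {r : ℕ} (n : Fin r → ℕ) (z : ℂ) : ℂ :=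
  ∏ i : Fin r, if (i : ℕ) = 0 then 1 / ((n i : ℂ) + z) else 1 / (n i : ℂ)

/-- `P̃_r(n₁, …, n_r; z) = (1 / n₁ - 1 / (n₁ + z)) / (n₂ ⋯ n_r)`. -/
noncomputable def blockPTilde {r : ℕ} (n : Fin r → ℕ) (z : ℂ) : ℂ :=
  ∏ i : Fin r, if (i : ℕ) = 0 then 1 / (n i : ℂ) - 1 / ((n i : ℂ) + z) else 1 / (n i : ℂ)

/-- The range of summation of the multiple series `G_α`. The variables come in blocks, block `j`
having `αⱼ` of them. They are positive, strictly decrease inside each block, and the variables of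
a block are `≥` those of every later block (equivalently, as blocks are not empty, the last
variable of each block is `≥` the first variable of the next block). -/
def BlockChain {m : ℕ} (α : Composition m) : Type :=
  {n : (j : Fin α.length) → Fin (α.blocksFun j) → ℕ //
    (∀ j i, 0 < n j i) ∧ (∀ j, StrictAnti (n j)) ∧
    (∀ j j', j < j' → ∀ i i', n j' i' ≤ n j i)}

/-- The term `P̃_{α₁} P_{α₂} ⋯ P_{αₛ}` of the multiple series `G_α(z)`. -/
noncomputable def multipleTerm {m : ℕ} (α : Composition m) (z : ℂ) (n : BlockChain α) : ℂ :=
  ∏ j : Fin α.length, if (j : ℕ) = 0 then blockPTilde (n.1 j) z else blockP (n.1 j) z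

/-- The multiple series `G_α(z)`. -/
noncomputable def multipleSeries {m : ℕ} (α : Composition m) (z : ℂ) : ℂ :=
  ∑' n : BlockChain α, multipleTerm α z n

/-!
The Newton coefficients of `S_α` are found by duality. For `n ≥ 1` one has
`(∇ S_α)(n) = -(∇ s_α)(n - 1)`, where `s_α = -Δ S_α` is the harmonic sequence of `α`
(`harmonicSeq`). It arises from `1, 0, 0, …` by a word in the two operators `divSucc` (division by
`n + 1`) and `divSucc ∘ partialSums` (`harmonicSeq_eq_wordSeq`); the positions of the second operator are the
partial sums of `α`. The inversion operator `∇` exchanges the two operators (`invOp_divSucc`,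
`invOp_divSucc_partialSums`), so `∇ s_α = s_{α*}` (`invOp_harmonicSeq`) and, with indices
`n = ν + 1`, `F_α(z) = ∑ₙ (-1)ⁿ⁻¹ binom(z, n) s_{α*}(n - 1)`.

This series is turned into the multiple series by the connector
`c(n, k) = (-1)ⁿ⁻¹ binom(z, n) n! k! / (n + k)!`, which satisfies the two telescoping identities
`c(n, k) / n = ∑_{k' > k} c(n, k') / k'` (`hasSum_invChoose`) and
`∑_{n ≥ n'} c(n, k) / k = c(n', k - 1) / (k + z)` (`tsum_connector_ge`). Each factor `1 / n`, and
each summation over `n`, in `s_{α*}` is thereby transported to the variables `k`, which produces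
the blocks of the multiple series from the last to the first (`tsum_connector_harmonicSeq`,
`tsum_chainTerm`). All interchanges of summation follow by Fubini from the absolute convergence of
the Newton series for `Re z > -α₁*`: the binomial coefficients are `O(n ^ (-1 - Re z))`, and
`s_{α*}(n)` is `O(n ^ (ε - α₁*))` for every `ε > 0` (`summable_newtonTerm_mul_harmonicSeq`).

If the Newton series converged at some `z` with `Re z < -α₁*`, summation by parts would bound its
partial sums at every negative real `x > Re z` (`newtonPartialSum_bounded`). For `x < -α₁*` its
terms, apart from the vanishing one at `n = 0`, have constant sign and dominate a multiple of the
harmonic series (`not_bounded_sum_newtonTerm_mul_harmonicSeq`).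
-/

open scoped Nat

/-! ### Division, summation and duality of harmonic sequences -/

section Operators

variable {K : Type*} [Field K]

/-- The operator `s ↦ (n ↦ s(n) / (n + 1))` on sequences. -/
def divSucc (s : ℕ → K) : ℕ → K := fun n => s n / (n + 1)

/-- The operator `s ↦ (n ↦ s(0) + ⋯ + s(n))` on sequences. -/
def partialSums (s : ℕ → K) : ℕ → K := fun n => ∑ i ∈ Finset.range (n + 1), s i

/-- The sequence `1, 0, 0, …`. -/
def unitSeq (K : Type*) [Field K] : ℕ → K := fun n => if n = 0 then 1 else 0

/-- The harmonic sequence of a list of exponents: for a nonempty list `a₁, …, aₛ` it is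
`n ↦ ∑_{n = n₁ ≥ ⋯ ≥ nₛ ≥ 0} ∏ 1 / (nᵢ + 1)^aᵢ`. The value `1, 0, 0, …` at the empty list makes
the recursion uniform, as its partial sums are constantly `1`. -/
def harmonicSeq (K : Type*) [Field K] : List ℕ → ℕ → K
  | [] => unitSeq K
  | a :: L => divSucc^[a] (partialSums (harmonicSeq K L))

/-- The sequence obtained from `1, 0, 0, …` by a word of length `m` in the two operators `divSucc`
and `divSucc ∘ partialSums`; the letter in position `p < m` (the outermost one being `p = 0`) is
the second operator when `w p` holds. -/
noncomputable def wordSeq (K : Type*) [Field K] : (ℕ → Prop) → ℕ → ℕ → K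
  | _, 0 => unitSeq K
  | w, m + 1 => open Classical in
      if w 0 then divSucc (partialSums (wordSeq K (fun p => w (p + 1)) m))
      else divSucc (wordSeq K (fun p => w (p + 1)) m)

theorem divSucc_iterate_apply (a : ℕ) (s : ℕ → K) (n : ℕ) :
    (divSucc^[a] s) n = s n / ((n : K) + 1) ^ a := by
  induction a generalizing s with
  | zero => simp
  | succ a ih => rw [Function.iterate_succ_apply, ih, divSucc, div_div, pow_succ']

theorem partialSums_unitSeq (n : ℕ) : partialSums (unitSeq K) n = 1 := by
  simp [partialSums, unitSeq]

theorem wordSeq_append {w : ℕ → Prop} {a : ℕ} (m : ℕ) (hw : ∀ p < a, ¬ w p) (ha : w a) :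
    wordSeq K w (a + 1 + m)
      = divSucc^[a + 1] (partialSums (wordSeq K (fun p => w (p + (a + 1))) m)) := by
  induction a generalizing w with
  | zero =>
    rw [zero_add, add_comm 1 m, wordSeq, if_pos ha]
    rfl
  | succ a ih =>
    rw [show a + 1 + 1 + m = (a + 1 + m) + 1 by ring, wordSeq, if_neg (hw 0 (by omega)),
      ih (fun p hp => hw (p + 1) (by omega)) ha, ← Function.iterate_succ_apply' divSucc]
    rfl

/-- The harmonic sequence of `L` is given by the word whose second letters sit at the partial sums
of `L`. -/
theorem harmonicSeq_eq_wordSeq (L : List ℕ) (hL : ∀ a ∈ L, 0 < a) (w : ℕ → Prop)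
    (hw : ∀ p < L.sum, (w p ↔ ∃ j, (L.take j).sum = p + 1)) :
    harmonicSeq K L = wordSeq K w L.sum := by
  induction L generalizing w with
  | nil => rfl
  | cons a L ih =>
    obtain ⟨b, rfl⟩ : ∃ b, a = b + 1 := ⟨a - 1, by have := hL a (by simp); omega⟩
    rw [List.sum_cons] at hw ⊢
    rw [wordSeq_append, harmonicSeq, ih (fun x hx => hL x (by simp [hx]))]
    · intro p hp
      rw [hw _ (by omega)]
      constructor
      · rintro ⟨j, hj⟩
        cases j with
        | zero => simp at hj
        | succ j =>
          rw [List.take_succ_cons, List.sum_cons] at hj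
          exact ⟨j, by omega⟩
      · rintro ⟨j, hj⟩
        exact ⟨j + 1, by rw [List.take_succ_cons, List.sum_cons]; omega⟩
    · intro p hp h
      obtain ⟨j, hj⟩ := (hw p (by omega)).1 h
      cases j with
      | zero => simp at hj
      | succ j =>
        rw [List.take_succ_cons, List.sum_cons] at hj
        omega
    · exact (hw b (by omega)).2 ⟨1, by simp⟩

end Operators

theorem harmonicSeq_ofReal (L : List ℕ) (n : ℕ) :
    ((harmonicSeq ℝ L n : ℝ) : ℂ) = harmonicSeq ℂ L n := by
  induction L generalizing n with
  | nil => simp only [harmonicSeq, unitSeq]; split_ifs <;> simp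
  | cons a L ih =>
    simp only [harmonicSeq, divSucc_iterate_apply, partialSums]
    push_cast
    simp only [ih]

theorem harmonicSeq_nonneg (L : List ℕ) (n : ℕ) : 0 ≤ harmonicSeq ℝ L n := by
  induction L generalizing n with
  | nil => simp only [harmonicSeq, unitSeq]; split_ifs <;> norm_num
  | cons a L ih =>
    simp only [harmonicSeq, divSucc_iterate_apply, partialSums]
    exact div_nonneg (Finset.sum_nonneg fun i _ => ih i) (by positivity)

/-! ### Iterated differences -/

/-- Iterated differences of `b` and of `a(n) = (n + 1) b(n)`. -/
theorem diffOp_iterate_mul_succ {a b : ℕ → ℂ} (h : ∀ j, a j = ((j : ℂ) + 1) * b j) (n j : ℕ) :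
    (diffOp^[n + 1] a) j
      = ((j : ℂ) + 1) * (diffOp^[n + 1] b) j - (n + 1) * (diffOp^[n] b) (j + 1) := by
  induction n generalizing j with
  | zero =>
    simp only [zero_add, Function.iterate_one, Function.iterate_zero, id, diffOp, h]
    push_cast; ring
  | succ n ih =>
    rw [Function.iterate_succ_apply' diffOp, diffOp, ih, ih,
      Function.iterate_succ_apply' _ (n + 1) b, diffOp]
    have := congrFun (Function.iterate_succ_apply' diffOp n b) (j + 1)
    rw [diffOp] at this
    push_cast
    linear_combination ((n : ℂ) + 1) * this

/-- Iterated differences of `b` and of `a(n) = (n + 1) b(n) - n b(n - 1)`. -/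
theorem diffOp_iterate_cesaro {a b : ℕ → ℂ} (h0 : a 0 = b 0)
    (h : ∀ j, a (j + 1) = ((j : ℂ) + 2) * b (j + 1) - (j + 1) * b j) (n : ℕ) :
    (diffOp^[n] a) 0 = ((n : ℂ) + 1) * (diffOp^[n] b) 0 ∧ ∀ j, (diffOp^[n] a) (j + 1)
      = ((n : ℂ) + 2 + j) * (diffOp^[n] b) (j + 1) - (j + 1) * (diffOp^[n] b) j := by
  induction n with
  | zero =>
    refine ⟨by simp [h0], fun j => ?_⟩
    simp only [Function.iterate_zero, id, h]
    push_cast; ring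
  | succ n ih =>
    simp only [Function.iterate_succ_apply', diffOp]
    refine ⟨?_, fun j => ?_⟩
    · rw [ih.1, ih.2 0]; push_cast; ring
    · rw [ih.2 j, ih.2 (j + 1)]; push_cast; ring

/-- The inversion operator exchanges the two letters: `∇ ∘ divSucc = divSucc ∘ partialSums ∘ ∇`. -/
theorem invOp_divSucc (a : ℕ → ℂ) : invOp (divSucc a) = divSucc (partialSums (invOp a)) := by
  have h : ∀ j, a j = ((j : ℂ) + 1) * divSucc a j := fun j => by
    rw [divSucc, mul_div_cancel₀ _ (Nat.cast_add_one_ne_zero j)]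
  have key : ∀ n : ℕ, ((n : ℂ) + 1) * invOp (divSucc a) n = partialSums (invOp a) n := by
    intro n
    induction n with
    | zero => simp [partialSums, invOp, divSucc]
    | succ n ih =>
      rw [partialSums, Finset.sum_range_succ, ← partialSums, ← ih]
      simp only [invOp]
      rw [diffOp_iterate_mul_succ h]
      have := congrFun (Function.iterate_succ_apply' diffOp n (divSucc a)) 0
      rw [diffOp] at this
      push_cast
      linear_combination ((n : ℂ) + 1) * this
  funext n
  rw [divSucc, eq_div_iff (Nat.cast_add_one_ne_zero n), ← key, mul_comm]

/-- The inversion operator exchanges the two letters: `∇ ∘ divSucc ∘ partialSums = divSucc ∘ ∇`. -/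
theorem invOp_divSucc_partialSums (a : ℕ → ℂ) :
    invOp (divSucc (partialSums a)) = divSucc (invOp a) := by
  have h : ∀ j : ℕ, ((j : ℂ) + 1) * divSucc (partialSums a) j = partialSums a j := fun j => by
    rw [divSucc, mul_div_cancel₀ _ (Nat.cast_add_one_ne_zero j)]
  funext n
  rw [divSucc, eq_div_iff (Nat.cast_add_one_ne_zero n), mul_comm, eq_comm]
  refine (diffOp_iterate_cesaro ?_ ?_ n).1
  · simp [divSucc, partialSums]
  · intro j
    have h1 := h (j + 1)
    rw [partialSums, Finset.sum_range_succ, ← partialSums, ← h j] at h1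
    push_cast at h1
    linear_combination -h1

theorem invOp_unitSeq (n : ℕ) : invOp (unitSeq ℂ) n = 1 := by
  have : ∀ n : ℕ, ∀ j, (diffOp^[n] (unitSeq ℂ)) j = if j = 0 then 1 else 0 := by
    intro n
    induction n with
    | zero => intro j; rfl
    | succ n ih =>
      intro j
      rw [Function.iterate_succ_apply', diffOp, ih, ih]
      simp
  exact (this n 0).trans (if_pos rfl)

/-- Duality: the inversion operator complements all letters of a word but the innermost. -/
theorem invOp_wordSeq {w w' : ℕ → Prop} {m : ℕ} (h : ∀ p < m, (w' p ↔ ¬ w p)) (hm : w m)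
    (hm' : w' m) : invOp (wordSeq ℂ w (m + 1)) = wordSeq ℂ w' (m + 1) := by
  induction m generalizing w w' with
  | zero =>
    simp only [wordSeq, if_pos hm, if_pos hm']
    rw [invOp_divSucc_partialSums]
    funext n
    rw [divSucc, divSucc, invOp_unitSeq, partialSums_unitSeq]
  | succ m ih =>
    have ih' := ih (w := fun p => w (p + 1)) (w' := fun p => w' (p + 1))
      (fun p hp => h (p + 1) (by omega)) hm hm'
    rw [wordSeq, wordSeq.eq_2 ℂ w']
    by_cases h0 : w 0
    · rw [if_pos h0, if_neg (by rw [h 0 (by omega)]; exact not_not.2 h0),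
        invOp_divSucc_partialSums, ih']
    · rw [if_neg h0, if_pos ((h 0 (by omega)).2 h0), invOp_divSucc, ih']

/-! ### The Newton coefficients of a finite multiple harmonic sum -/

theorem mem_multiIndexEquiv {m : ℕ} (c : Composition m) (i : Fin (m - 1)) :
    i ∈ multiIndexEquiv m c ↔ ∃ j, (c.blocks.take j).sum = i + 1 := by
  have : i ∈ multiIndexEquiv m c ↔
      (⟨1 + (i : ℕ), by omega⟩ : Fin m.succ) ∈ c.boundaries := by
    simp [multiIndexEquiv, compositionAsSetEquiv, compositionEquiv,
      Composition.toCompositionAsSet]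
  rw [this]
  simp only [Composition.boundaries, Finset.mem_map, Finset.mem_univ, true_and]
  constructor
  · rintro ⟨j, hj⟩
    refine ⟨j, ?_⟩
    have := congrArg Fin.val hj
    simp only [RelEmbedding.coe_toEmbedding, Composition.boundary, OrderEmbedding.coe_ofStrictMono,
      Composition.sizeUpTo] at this
    omega
  · rintro ⟨j, hj⟩
    by_cases hlt : j < c.length + 1
    · refine ⟨⟨j, hlt⟩, Fin.ext ?_⟩
      simp only [RelEmbedding.coe_toEmbedding, Composition.boundary,
        OrderEmbedding.coe_ofStrictMono, Composition.sizeUpTo]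
      omega
    · rw [List.take_of_length_le (by simp only [Composition.length] at hlt; omega),
        c.blocks_sum] at hj
      have := i.2
      omega

theorem harmonicSeq_blocks_eq_wordSeq {K : Type*} [Field K] {m : ℕ} (c : Composition m) :
    harmonicSeq K c.blocks = wordSeq K (fun p => ∃ j, (c.blocks.take j).sum = p + 1) m := by
  have := harmonicSeq_eq_wordSeq (K := K) c.blocks (fun a ha => c.blocks_pos ha)
    (fun p => ∃ j, (c.blocks.take j).sum = p + 1) fun p _ => Iff.rfl
  rwa [c.blocks_sum] at this

/-- Duality for harmonic sequences: `∇ s_α = s_{α*}`. -/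
theorem invOp_harmonicSeq {m : ℕ} (hm : 0 < m) (α : Composition m) :
    invOp (harmonicSeq ℂ α.blocks) = harmonicSeq ℂ (hoffmanDual α).blocks := by
  obtain ⟨n, rfl⟩ : ∃ n, m = n + 1 := ⟨m - 1, by omega⟩
  rw [harmonicSeq_blocks_eq_wordSeq, harmonicSeq_blocks_eq_wordSeq]
  refine invOp_wordSeq (fun p hp => ?_) ⟨α.blocks.length, by simp⟩
    ⟨(hoffmanDual α).blocks.length, by simp⟩
  have h1 := mem_multiIndexEquiv α ⟨p, by omega⟩
  have h2 := mem_multiIndexEquiv (hoffmanDual α) ⟨p, by omega⟩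
  simp only at h1 h2
  rw [← h1, ← h2, hoffmanDual, Equiv.apply_symm_apply, Finset.mem_compl]

open Classical in
/-- A finite multiple harmonic sum is a partial sum of a harmonic sequence. The case `s = n = 0` is
excluded because there the left side is `1`, from the empty family, and the right side is `0`. -/
theorem sum_antitone_eq_sum_harmonicSeq (s : ℕ) (a : Fin s → ℕ) (n : ℕ) (hn : s ≠ 0 ∨ n ≠ 0) :
    (∑ k : Fin s → Fin n with Antitone k, ∏ i, 1 / (((k i : ℕ) : ℂ) + 1) ^ a i)
      = ∑ i ∈ Finset.range n, harmonicSeq ℂ (List.ofFn a) i := by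
  induction s generalizing n with
  | zero =>
    obtain ⟨n, rfl⟩ := Nat.exists_eq_succ_of_ne_zero (by simpa using hn)
    rw [List.ofFn_zero, harmonicSeq]
    have := partialSums_unitSeq (K := ℂ) n
    rw [partialSums] at this
    rw [this, Finset.filter_true_of_mem fun k _ i => i.elim0]
    simp
  | succ s ih =>
    rw [← Fin.sum_univ_eq_sum_range (harmonicSeq ℂ (List.ofFn a)) n]
    have hstep : ∀ i : Fin n, harmonicSeq ℂ (List.ofFn a) i
        = ∑ k : Fin s → Fin (i + 1) with Antitone k,
          1 / (((i : ℕ) : ℂ) + 1) ^ a 0 * ∏ j, 1 / (((k j : ℕ) : ℂ) + 1) ^ a j.succ := by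
      intro i
      rw [List.ofFn_succ, harmonicSeq, divSucc_iterate_apply, partialSums, ← Finset.mul_sum,
        ih _ _ (Or.inr (by omega))]
      ring
    simp only [hstep, Finset.sum_sigma']
    symm
    refine Finset.sum_bij
      (fun p _ => Fin.cons p.1 fun j => ⟨p.2 j, (p.2 j).2.trans_le p.1.2⟩) ?_ ?_ ?_ ?_
    · rintro ⟨i, k⟩ hk
      simp only [Finset.mem_sigma, Finset.mem_filter, Finset.mem_univ, true_and] at hk ⊢
      intro x y hxy
      induction x using Fin.cases with
      | zero =>
        induction y using Fin.cases with
        | zero => exact le_rfl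
        | succ y => exact Fin.le_def.2 (Nat.lt_succ_iff.1 (k y).2)
      | succ x =>
        induction y using Fin.cases with
        | zero => exact absurd hxy (by simp)
        | succ y => exact Fin.le_def.2 (Fin.le_def.1 (hk (Fin.succ_le_succ_iff.1 hxy)))
    · rintro ⟨i, k⟩ _ ⟨i', k'⟩ _ heq
      obtain rfl : i = i' := by simpa using congrFun heq 0
      congr 1
      funext j
      have := congrArg Fin.val (congrFun heq j.succ)
      exact Fin.ext (by simpa using this)
    · intro k hk
      simp only [Finset.mem_filter, Finset.mem_univ, true_and] at hk
      refine ⟨⟨k 0, fun j => ⟨k j.succ, Nat.lt_succ_of_le (hk (Fin.zero_le _))⟩⟩, ?_, ?_⟩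
      · simp only [Finset.mem_sigma, Finset.mem_filter, Finset.mem_univ, true_and]
        intro x y hxy
        exact Fin.le_def.2 (Fin.le_def.1 (hk (Fin.succ_le_succ_iff.2 hxy)))
      · funext j
        induction j using Fin.cases with
        | zero => rfl
        | succ j => rfl
    · rintro ⟨i, k⟩ _
      rw [Fin.prod_univ_succ]
      rfl

theorem harmonicSum_eq_sum_harmonicSeq {m : ℕ} (hm : 0 < m) (α : Composition m) (n : ℕ) :
    harmonicSum α n = ∑ i ∈ Finset.range n, harmonicSeq ℂ α.blocks i := by
  rw [harmonicSum, sum_antitone_eq_sum_harmonicSeq _ _ _ (Or.inl (α.length_pos_of_pos hm).ne'),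
    α.ofFn_blocksFun]

theorem invOp_harmonicSum_zero {m : ℕ} (hm : 0 < m) (α : Composition m) :
    invOp (harmonicSum α) 0 = 0 := by
  simp [invOp, harmonicSum_eq_sum_harmonicSeq hm]

theorem invOp_harmonicSum_succ {m : ℕ} (hm : 0 < m) (α : Composition m) (n : ℕ) :
    invOp (harmonicSum α) (n + 1) = -harmonicSeq ℂ (hoffmanDual α).blocks n := by
  have h : diffOp (harmonicSum α) = fun n => -harmonicSeq ℂ α.blocks n := by
    funext n
    simp only [diffOp, harmonicSum_eq_sum_harmonicSeq hm, Finset.sum_range_succ]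
    ring
  have hneg : ∀ (a : ℕ → ℂ) (n j : ℕ), (diffOp^[n] fun n => -a n) j = -(diffOp^[n] a) j := by
    intro a n
    induction n with
    | zero => intro j; rfl
    | succ n ih =>
      intro j
      simp only [Function.iterate_succ_apply', diffOp, ih]
      ring
  rw [invOp, Function.iterate_succ_apply, h, hneg, ← invOp_harmonicSeq hm, invOp]

/-! ### The connector -/

/-- The coefficient `(-1)ⁿ⁻¹ binom(z, n)` with `n = ν + 1`. -/
noncomputable def newtonTerm (z : ℂ) (ν : ℕ) : ℂ := (-1) ^ ν * complexBinom z (ν + 1)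

/-- The quotient `n! k! / (n + k)!` with `n = ν + 1`. -/
noncomputable def invChoose (ν k : ℕ) : ℝ := ((ν + 1)! * k ! : ℝ) / (ν + 1 + k)!

/-- The connector `(-1)ⁿ⁻¹ binom(z, n) n! k! / (n + k)!` with `n = ν + 1`, which links the summation
variable `n` of the Newton series to the summation variable `k` of the multiple series. -/
noncomputable def connector (z : ℂ) (k ν : ℕ) : ℂ := newtonTerm z ν * invChoose ν k

theorem invChoose_pos (ν k : ℕ) : 0 < invChoose ν k := by
  unfold invChoose; positivity

theorem invChoose_zero_right (ν : ℕ) : invChoose ν 0 = 1 := by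
  have : ((ν + 1)! : ℝ) ≠ 0 := by positivity
  simp [invChoose, this]

theorem invChoose_succ_right (ν k : ℕ) :
    invChoose ν (k + 1) = invChoose ν k * (k + 1) / (ν + k + 2) := by
  unfold invChoose
  rw [← add_assoc, Nat.factorial_succ k, Nat.factorial_succ (ν + 1 + k)]
  have h1 : ((ν + 1 + k)! : ℝ) ≠ 0 := by positivity
  push_cast
  have h2 : (ν : ℝ) + 1 + k + 1 ≠ 0 := by positivity
  have h3 : (ν : ℝ) + k + 2 ≠ 0 := by positivity
  field_simp
  ring

theorem invChoose_succ_left (ν k : ℕ) :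
    invChoose (ν + 1) k = invChoose ν k * (ν + 2) / (ν + k + 2) := by
  unfold invChoose
  rw [show ν + 1 + 1 + k = (ν + 1 + k) + 1 by ring, Nat.factorial_succ (ν + 1),
    Nat.factorial_succ (ν + 1 + k)]
  have h1 : ((ν + 1 + k)! : ℝ) ≠ 0 := by positivity
  push_cast
  have h2 : (ν : ℝ) + 1 + k + 1 ≠ 0 := by positivity
  have h3 : (ν : ℝ) + k + 2 ≠ 0 := by positivity
  field_simp
  ring

theorem newtonTerm_zero (z : ℂ) : newtonTerm z 0 = z := by
  simp [newtonTerm, complexBinom]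

theorem newtonTerm_succ (z : ℂ) (ν : ℕ) :
    newtonTerm z (ν + 1) = newtonTerm z ν * (ν + 1 - z) / (ν + 2) := by
  unfold newtonTerm complexBinom
  rw [Finset.prod_range_succ, Nat.factorial_succ (ν + 1)]
  have h1 : ((ν + 1)! : ℂ) ≠ 0 := by exact_mod_cast (ν + 1).factorial_ne_zero
  have h2 : (ν : ℂ) + 2 ≠ 0 := by exact_mod_cast (ν + 1).succ_ne_zero
  have h3 : (ν : ℂ) + 1 + 1 ≠ 0 := by exact_mod_cast (ν + 1).succ_ne_zero
  push_cast
  field_simp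
  ring

theorem connector_zero_left (z : ℂ) (ν : ℕ) : connector z 0 ν = newtonTerm z ν := by
  simp [connector, invChoose_zero_right]

theorem connector_zero_right (z : ℂ) (k : ℕ) : connector z k 0 = z / (k + 1) := by
  rw [connector, newtonTerm_zero, invChoose, zero_add, add_comm 1 k, Nat.factorial_succ k]
  have : (k ! : ℂ) ≠ 0 := by exact_mod_cast k.factorial_ne_zero
  have h2 : (k : ℂ) + 1 ≠ 0 := Nat.cast_add_one_ne_zero k
  push_cast
  field_simp
  simp

theorem invChoose_le_one_div (ν k : ℕ) : invChoose ν k ≤ 1 / (k + 1) := by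
  induction ν with
  | zero =>
    rw [invChoose, zero_add, add_comm 1 k, Nat.factorial_succ k]
    have : (k ! : ℝ) ≠ 0 := by positivity
    push_cast
    apply le_of_eq
    field_simp
    simp
  | succ ν ih =>
    refine le_trans ?_ ih
    rw [invChoose_succ_left, div_le_iff₀ (by positivity)]
    have := (invChoose_pos ν k).le
    gcongr
    linarith [(Nat.cast_nonneg k : (0 : ℝ) ≤ k)]

/-- Transport of a factor `1 / n` through the connector: it becomes a summation over `k' > k` with
the factor `1 / k'`. -/
theorem hasSum_invChoose (ν k : ℕ) :
    HasSum (fun j : ℕ => invChoose ν (k + 1 + j) / ((k : ℝ) + 1 + j))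
      (invChoose ν k / (ν + 1)) := by
  have hterm : ∀ j : ℕ, invChoose ν (k + 1 + j) / ((k : ℝ) + 1 + j)
      = (invChoose ν (k + j) - invChoose ν (k + (j + 1))) / (ν + 1) := by
    intro j
    rw [show k + 1 + j = k + j + 1 by ring, ← add_assoc k j 1, invChoose_succ_right]
    push_cast
    have h1 : (k : ℝ) + 1 + j ≠ 0 := by positivity
    have h2 : (ν : ℝ) + 1 ≠ 0 := by positivity
    have h3 : (ν : ℝ) + (k + j) + 2 ≠ 0 := by positivity
    field_simp
    ring
  rw [hasSum_iff_tendsto_nat_of_nonneg fun j =>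
    div_nonneg (invChoose_pos _ _).le (by positivity)]
  simp only [hterm, ← Finset.sum_div]
  have h0 : Tendsto (fun N => invChoose ν (k + N)) atTop (𝓝 0) := by
    refine squeeze_zero (fun N => (invChoose_pos _ _).le) (fun N => ?_)
      (tendsto_one_div_add_atTop_nhds_zero_nat (𝕜 := ℝ))
    refine (invChoose_le_one_div _ _).trans (one_div_le_one_div_of_le (by positivity) ?_)
    push_cast
    linarith [(Nat.cast_nonneg k : (0 : ℝ) ≤ k)]
  have := (h0.const_sub (invChoose ν k)).div_const ((ν : ℝ) + 1)
  rw [sub_zero] at this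
  refine this.congr fun N => ?_
  rw [Finset.sum_range_sub' fun j => invChoose ν (k + j)]
  simp

theorem connector_sub_succ {z : ℂ} {k : ℕ} (ν : ℕ) :
    connector z k ν - connector z k (ν + 1)
      = (k + 1 + z) / (k + 1) * connector z (k + 1) ν := by
  simp only [connector, newtonTerm_succ, invChoose_succ_left, invChoose_succ_right]
  have h1 : (k : ℂ) + 1 ≠ 0 := Nat.cast_add_one_ne_zero k
  have h2 : (ν : ℂ) + 2 ≠ 0 := by exact_mod_cast (ν + 1).succ_ne_zero
  have h3 : (ν : ℂ) + k + 2 ≠ 0 := by exact_mod_cast (ν + k + 1).succ_ne_zero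
  push_cast
  field_simp
  ring

/-! ### Asymptotic bounds -/

/-- The coefficients of a Newton series at `z` are `O(n^(-1 - Re z))`. For `z ∉ ℕ` this is Gauss's
product formula for `Γ(-z)`; for `z ∈ ℕ` they vanish eventually. -/
theorem newtonTerm_isBigO (z : ℂ) :
    newtonTerm z =O[atTop] fun ν : ℕ => (ν : ℝ) ^ (-1 - z.re) := by
  by_cases hz : ∃ n : ℕ, z = n
  · obtain ⟨n, rfl⟩ := hz
    refine Asymptotics.IsBigO.of_bound 0 ?_
    filter_upwards [eventually_ge_atTop n] with ν hν
    have : ∏ i ∈ Finset.range (ν + 1), ((n : ℂ) - i) = 0 :=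
      Finset.prod_eq_zero (Finset.mem_range.2 (Nat.lt_succ_of_le hν)) (sub_self _)
    simp [newtonTerm, complexBinom, this]
  · push Not at hz
    have hΓ : Complex.Gamma (-z) ≠ 0 := by
      refine Complex.Gamma_ne_zero fun m hm => hz m (neg_injective hm)
    have hlim := (Complex.GammaSeq_tendsto_Gamma (-z)).norm
    have hpos : 0 < ‖Complex.Gamma (-z)‖ := norm_pos_iff.2 hΓ
    refine Asymptotics.IsBigO.of_bound (2 / ‖Complex.Gamma (-z)‖) ?_
    filter_upwards [hlim.eventually (lt_mem_nhds (half_lt_self hpos)), eventually_ge_atTop 1]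
      with ν hν h1
    have hν0 : (0 : ℝ) < ν := by exact_mod_cast h1
    have hprod : ∏ j ∈ Finset.range (ν + 1), (-z + (j : ℂ)) ≠ 0 :=
      Finset.prod_ne_zero_iff.2 fun j _ h => hz j (by linear_combination -h)
    have hnorm : ‖newtonTerm z ν‖ * ‖Complex.GammaSeq (-z) ν‖ = (ν : ℝ) ^ (-z.re) / (ν + 1) := by
      have hp : ‖∏ i ∈ Finset.range (ν + 1), (z - (i : ℂ))‖
          = ‖∏ j ∈ Finset.range (ν + 1), (-z + (j : ℂ))‖ := by
        rw [norm_prod, norm_prod]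
        refine Finset.prod_congr rfl fun i _ => ?_
        rw [← norm_neg]; ring_nf
      have hp0 := norm_ne_zero_iff.2 hprod
      have hf : ((ν)! : ℝ) ≠ 0 := by positivity
      rw [newtonTerm, complexBinom, Complex.GammaSeq, norm_mul, norm_div, hp, norm_div, norm_mul,
        norm_pow, norm_neg, norm_one, one_pow, one_mul, Complex.norm_natCast_cpow_of_pos h1,
        Complex.norm_natCast, Complex.norm_natCast, Complex.neg_re, Nat.factorial_succ]
      push_cast
      field_simp
    have hG : 0 < ‖Complex.GammaSeq (-z) ν‖ := (half_pos hpos).trans hν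
    rw [Real.norm_of_nonneg (Real.rpow_nonneg hν0.le _), show -1 - z.re = -z.re - 1 by ring,
      Real.rpow_sub_one hν0.ne', ← mul_le_mul_iff_left₀ hG, hnorm]
    calc (ν : ℝ) ^ (-z.re) / (ν + 1) ≤ (ν : ℝ) ^ (-z.re) / ν := by
          have := Real.rpow_nonneg hν0.le (-z.re)
          gcongr; linarith
      _ = 2 / ‖Complex.Gamma (-z)‖ * ((ν : ℝ) ^ (-z.re) / ν) * (‖Complex.Gamma (-z)‖ / 2) := by
          field_simp
      _ ≤ _ := by gcongr

theorem invChoose_isBigO (k : ℕ) :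
    (fun ν => invChoose ν k) =O[atTop] fun ν : ℕ => (ν : ℝ) ^ (-(k : ℝ)) := by
  refine Asymptotics.IsBigO.of_bound (k ! : ℝ) ?_
  filter_upwards [eventually_ge_atTop 1] with ν h1
  have hν0 : (0 : ℝ) < ν := by exact_mod_cast h1
  rw [Real.norm_of_nonneg (invChoose_pos _ _).le, Real.norm_of_nonneg (by positivity),
    Real.rpow_neg hν0.le, Real.rpow_natCast, invChoose, ← div_eq_mul_inv,
    div_le_div_iff₀ (by positivity) (by positivity)]
  have h := Nat.factorial_mul_pow_le_factorial (m := ν + 1) (n := k)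
  have h' : (((ν + 1)! : ℕ) : ℝ) * (ν : ℝ) ^ k ≤ ((ν + 1 + k)! : ℕ) := by
    refine le_trans ?_ (by exact_mod_cast h : (((ν + 1)! : ℕ) : ℝ) * ((ν + 1 + 1 : ℕ) : ℝ) ^ k ≤ _)
    push_cast
    gcongr
    linarith
  nlinarith [(by positivity : (0 : ℝ) < k !)]

theorem tendsto_connector {z : ℂ} {k : ℕ} (h : 0 < (k : ℝ) + 1 + z.re) :
    Tendsto (connector z k) atTop (𝓝 0) := by
  have h1 : connector z k =O[atTop] fun ν : ℕ => (ν : ℝ) ^ (-((k : ℝ) + 1 + z.re)) := by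
    have hc : (fun ν => ((invChoose ν k : ℝ) : ℂ)) =O[atTop] fun ν : ℕ => (ν : ℝ) ^ (-(k : ℝ)) := by
      refine Asymptotics.IsBigO.of_norm_left ?_
      simp only [Complex.norm_real]
      exact (invChoose_isBigO k).norm_left
    refine ((newtonTerm_isBigO z).mul hc).congr' EventuallyEq.rfl ?_
    filter_upwards [eventually_ge_atTop 1] with ν hν
    rw [← Real.rpow_add (by exact_mod_cast hν)]
    ring_nf
  exact h1.trans_tendsto ((tendsto_rpow_neg_atTop h).comp tendsto_natCast_atTop_atTop)

/-- The partial sums of a harmonic sequence are bounded by a power of the harmonic numbers. -/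
theorem partialSums_harmonicSeq_le (L : List ℕ) (hL : ∀ a ∈ L, 0 < a) (ν : ℕ) :
    partialSums (harmonicSeq ℝ L) ν ≤ (1 + Real.log (ν + 1)) ^ L.length := by
  induction L generalizing ν with
  | nil => simp [harmonicSeq, partialSums_unitSeq]
  | cons a L ih =>
    have hlog : ∀ i : ℕ, 0 ≤ 1 + Real.log ((i : ℝ) + 1) := fun i => by
      have := Real.log_nonneg (by linarith [(Nat.cast_nonneg i : (0 : ℝ) ≤ i)] : (1 : ℝ) ≤ i + 1)
      linarith
    calc partialSums (harmonicSeq ℝ (a :: L)) ν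
        ≤ ∑ i ∈ Finset.range (ν + 1), (1 + Real.log (ν + 1)) ^ L.length * ((i : ℝ) + 1)⁻¹ := by
          refine Finset.sum_le_sum fun i hi => ?_
          rw [harmonicSeq, divSucc_iterate_apply, div_eq_mul_inv]
          have hi' : (i : ℝ) ≤ ν := by exact_mod_cast Nat.lt_succ_iff.1 (Finset.mem_range.1 hi)
          have h1 : (1 : ℝ) ≤ i + 1 := by linarith [(Nat.cast_nonneg i : (0 : ℝ) ≤ i)]
          have h2 : (i : ℝ) + 1 ≤ (i + 1) ^ a := le_self_pow₀ h1 (hL a (by simp)).ne'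
          have h3 := (ih (fun x hx => hL x (by simp [hx])) i).trans
            (pow_le_pow_left₀ (hlog i) (by gcongr : 1 + Real.log ((i : ℝ) + 1)
              ≤ 1 + Real.log (ν + 1)) _)
          have h4 := hlog ν
          gcongr
      _ = (1 + Real.log (ν + 1)) ^ L.length * (harmonic (ν + 1) : ℝ) := by
          rw [← Finset.mul_sum, harmonic]
          push_cast
          rfl
      _ ≤ _ := by
          rw [List.length_cons, pow_succ]
          have := harmonic_le_one_add_log (ν + 1)
          push_cast at this
          exact mul_le_mul_of_nonneg_left this (pow_nonneg (hlog ν) _)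

theorem harmonicSeq_isBigO (a : ℕ) (L : List ℕ) (hL : ∀ a ∈ L, 0 < a) {δ : ℝ} (hδ : 0 < δ) :
    harmonicSeq ℝ (a :: L) =O[atTop] fun ν : ℕ => (ν : ℝ) ^ (δ - a) := by
  have hlog : (fun ν : ℕ => 1 + Real.log ((ν : ℝ) + 1)) =O[atTop]
      fun ν : ℕ => (ν : ℝ) ^ (δ / (L.length + 1)) := by
    set ε := δ / (L.length + 1)
    have hε : 0 < ε := by positivity
    refine Asymptotics.IsBigO.of_bound (1 + 2 ^ ε / ε) ?_
    filter_upwards [eventually_ge_atTop 1] with ν h1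
    have hν1 : (1 : ℝ) ≤ ν := by exact_mod_cast h1
    have h2 := Real.log_le_rpow_div (by positivity : (0 : ℝ) ≤ (ν : ℝ) + 1) hε
    have h3 : ((ν : ℝ) + 1) ^ ε ≤ 2 ^ ε * (ν : ℝ) ^ ε := by
      rw [← Real.mul_rpow (by norm_num) (by positivity)]
      exact Real.rpow_le_rpow (by positivity) (by linarith) hε.le
    have h4 : (1 : ℝ) ≤ (ν : ℝ) ^ ε := Real.one_le_rpow hν1 hε.le
    have h5 := Real.log_nonneg (by linarith : (1 : ℝ) ≤ (ν : ℝ) + 1)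
    rw [Real.norm_of_nonneg (by positivity), Real.norm_of_nonneg (by positivity)]
    calc 1 + Real.log ((ν : ℝ) + 1) ≤ (ν : ℝ) ^ ε + 2 ^ ε * (ν : ℝ) ^ ε / ε :=
          add_le_add h4 (h2.trans (by gcongr))
      _ = _ := by ring
  have hP : partialSums (harmonicSeq ℝ L) =O[atTop] fun ν : ℕ => (ν : ℝ) ^ δ := by
    have h1 : partialSums (harmonicSeq ℝ L) =O[atTop]
        fun ν : ℕ => (1 + Real.log ((ν : ℝ) + 1)) ^ L.length := by
      refine Asymptotics.IsBigO.of_norm_le fun ν => ?_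
      have : 0 ≤ partialSums (harmonicSeq ℝ L) ν :=
        Finset.sum_nonneg fun i _ => harmonicSeq_nonneg L i
      rw [Real.norm_of_nonneg this]
      exact partialSums_harmonicSeq_le L hL ν
    refine (h1.trans (hlog.pow _)).trans (Asymptotics.IsBigO.of_bound 1 ?_)
    filter_upwards [eventually_ge_atTop 1] with ν h1
    have hν1 : (1 : ℝ) ≤ ν := by exact_mod_cast h1
    rw [Real.norm_of_nonneg (by positivity), Real.norm_of_nonneg (by positivity), one_mul,
      ← Real.rpow_natCast, ← Real.rpow_mul (by positivity)]
    refine Real.rpow_le_rpow_of_exponent_le hν1 ?_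
    rw [div_mul_eq_mul_div, div_le_iff₀ (by positivity)]
    nlinarith
  refine Asymptotics.IsBigO.trans ?_ ((hP.mul (Asymptotics.isBigO_refl
    (fun ν : ℕ => (ν : ℝ) ^ (-(a : ℝ))) atTop)).congr' EventuallyEq.rfl ?_)
  · refine Asymptotics.IsBigO.of_bound 1 ?_
    filter_upwards [eventually_ge_atTop 1] with ν h1
    have hν1 : (1 : ℝ) ≤ ν := by exact_mod_cast h1
    rw [harmonicSeq, divSucc_iterate_apply, one_mul, norm_div, norm_mul, div_eq_mul_inv]
    gcongr
    rw [Real.norm_of_nonneg (by positivity), Real.norm_of_nonneg (by positivity),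
      Real.rpow_neg (by positivity), Real.rpow_natCast]
    gcongr
    linarith
  · filter_upwards [eventually_ge_atTop 1] with ν hν
    rw [← Real.rpow_add (by exact_mod_cast hν)]
    ring_nf

/-- Absolute convergence of the Newton series to the right of its abscissa. -/
theorem summable_newtonTerm_mul_harmonicSeq {z : ℂ} {a : ℕ} {L : List ℕ} (hL : ∀ a ∈ L, 0 < a)
    (h : 0 < (a : ℝ) + z.re) :
    Summable fun ν => newtonTerm z ν * ((harmonicSeq ℝ (a :: L) ν : ℝ) : ℂ) := by
  have hs := harmonicSeq_isBigO a L hL (half_pos h)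
  have hs' : (fun ν => ((harmonicSeq ℝ (a :: L) ν : ℝ) : ℂ)) =O[atTop]
      fun ν : ℕ => (ν : ℝ) ^ (((a : ℝ) + z.re) / 2 - a) := by
    refine Asymptotics.IsBigO.of_norm_left ?_
    simp only [Complex.norm_real]
    exact hs.norm_left
  refine summable_of_isBigO_nat
    (g := fun ν : ℕ => (ν : ℝ) ^ (-1 - ((a : ℝ) + z.re) / 2)) ?_ ?_
  · exact Real.summable_nat_rpow.2 (by linarith)
  · refine ((newtonTerm_isBigO z).mul hs').congr' EventuallyEq.rfl ?_
    filter_upwards [eventually_ge_atTop 1] with ν hν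
    rw [← Real.rpow_add (by exact_mod_cast hν)]
    ring_nf

/-! ### Transport of the Newton series into an iterated series -/

/-- The operator `h ↦ (k ↦ ∑_{k' > k} h(k') / k')`. -/
noncomputable def upperSum (h : ℕ → ℂ) (k : ℕ) : ℂ := ∑' j : ℕ, h (k + 1 + j) / ((k : ℂ) + 1 + j)

/-- The operator `h ↦ (k ↦ k / (k + z) * h(k - 1))`. -/
noncomputable def shiftMul (z : ℂ) (h : ℕ → ℂ) (k : ℕ) : ℂ := k / (k + z) * h (k - 1)

/-- The multiple series with block sizes `a₁, …, aₜ` listed from the block of the smallest variables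
to that of the largest, all variables being `> k`, as an iterated sum. -/
noncomputable def iteratedSeries (z : ℂ) : List ℕ → ℕ → ℂ
  | [] => fun k => z / (k + 1)
  | a :: L => upperSum^[a] (shiftMul z (iteratedSeries z L))

/-- Transport of a division by `n`: Fubini for `∑_{n, k' > k}`. -/
theorem tsum_connector_divSucc {z : ℂ} {k : ℕ} {s : ℕ → ℝ}
    (hs : Summable fun ν => connector z k ν * ((divSucc s ν : ℝ) : ℂ)) :
    (∀ j, Summable fun ν => connector z (k + 1 + j) ν * (s ν : ℂ)) ∧
    ∑' ν, connector z k ν * ((divSucc s ν : ℝ) : ℂ)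
      = upperSum (fun k' => ∑' ν, connector z k' ν * (s ν : ℂ)) k := by
  have hsum : ∀ ν, HasSum
      (fun j : ℕ => connector z (k + 1 + j) ν * (s ν : ℂ) / ((k : ℂ) + 1 + j))
      (connector z k ν * ((divSucc s ν : ℝ) : ℂ)) := by
    intro ν
    have := (Complex.hasSum_ofReal.2 (hasSum_invChoose ν k)).mul_left (newtonTerm z ν * s ν)
    convert! this using 1
    · funext j
      rw [connector]; push_cast; ring
    · rw [connector, divSucc]; push_cast; ring
  have hnorm : ∀ ν, HasSum
      (fun j : ℕ => ‖connector z (k + 1 + j) ν * (s ν : ℂ) / ((k : ℂ) + 1 + j)‖)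
      ‖connector z k ν * ((divSucc s ν : ℝ) : ℂ)‖ := by
    intro ν
    have := (hasSum_invChoose ν k).mul_left (‖newtonTerm z ν‖ * ‖s ν‖)
    convert! this using 1
    · funext j
      have h1 : ‖(k : ℂ) + 1 + j‖ = (k : ℝ) + 1 + j := by
        rw [show (k : ℂ) + 1 + j = ((k + 1 + j : ℕ) : ℂ) by push_cast; ring, Complex.norm_natCast]
        push_cast; ring
      rw [connector, norm_div, norm_mul, norm_mul, Complex.norm_real, Complex.norm_real,
        Real.norm_of_nonneg (invChoose_pos _ _).le, h1]
      ring
    · have h1 : ‖(ν : ℝ) + 1‖ = ν + 1 := Real.norm_of_nonneg (by positivity)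
      rw [connector, divSucc, norm_mul, norm_mul, Complex.norm_real, Complex.norm_real,
        Real.norm_of_nonneg (invChoose_pos _ _).le, norm_div, h1]
      ring
  have hprod : Summable fun p : ℕ × ℕ =>
      connector z (k + 1 + p.2) p.1 * (s p.1 : ℂ) / ((k : ℂ) + 1 + p.2) := by
    refine Summable.of_norm ((summable_prod_of_nonneg fun p => norm_nonneg _).2
      ⟨fun ν => (hnorm ν).summable, ?_⟩)
    simp only [(hnorm _).tsum_eq]
    exact hs.norm
  have hk : ∀ j : ℕ, (k : ℂ) + 1 + j ≠ 0 := fun j => by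
    exact_mod_cast (by omega : k + 1 + j ≠ 0)
  refine ⟨fun j => ?_, ?_⟩
  · have := (hprod.prod_symm.prod_factor j).mul_right ((k : ℂ) + 1 + j)
    refine this.congr fun ν => ?_
    simp only [Prod.swap, div_mul_cancel₀ _ (hk j)]
  · calc ∑' ν, connector z k ν * ((divSucc s ν : ℝ) : ℂ)
        = ∑' ν, ∑' j : ℕ, connector z (k + 1 + j) ν * (s ν : ℂ) / ((k : ℂ) + 1 + j) :=
          tsum_congr fun ν => (hsum ν).tsum_eq.symm
      _ = ∑' j : ℕ, ∑' ν, connector z (k + 1 + j) ν * (s ν : ℂ) / ((k : ℂ) + 1 + j) :=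
          (Summable.tsum_comm (f := fun ν (j : ℕ) =>
            connector z (k + 1 + j) ν * (s ν : ℂ) / ((k : ℂ) + 1 + j)) hprod).symm
      _ = _ := by
          rw [upperSum]
          exact tsum_congr fun j => tsum_div_const

/-- Summation of the connector over `n ≥ i`. The series telescopes, and the connector tends to `0`
because of the condition on `z`. -/
theorem tsum_connector_ge {z : ℂ} {k : ℕ} (h : 0 < (k : ℝ) + 1 + z.re) (i : ℕ)
    (hs : Summable fun ν => if i ≤ ν then connector z (k + 1) ν else 0) :
    ∑' ν, (if i ≤ ν then connector z (k + 1) ν else 0)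
      = (k + 1) / (k + 1 + z) * connector z k i := by
  have hz : (k : ℂ) + 1 + z ≠ 0 := fun h0 => by
    have := congrArg Complex.re h0
    simp at this
    linarith
  have hk : (k : ℂ) + 1 ≠ 0 := Nat.cast_add_one_ne_zero k
  rw [← hs.sum_add_tsum_nat_add i, Finset.sum_eq_zero fun ν hν =>
    if_neg (by rw [Finset.mem_range] at hν; omega), zero_add]
  have h1 : ∀ ν, (if i ≤ ν + i then connector z (k + 1) (ν + i) else 0)
      = (k + 1) / (k + 1 + z) * (connector z k (ν + i) - connector z k (ν + 1 + i)) := by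
    intro ν
    rw [if_pos (by omega), add_right_comm ν 1 i, connector_sub_succ, ← mul_assoc,
      div_mul_div_cancel₀ hz, div_self hk, one_mul]
  refine HasSum.tsum_eq (((summable_nat_add_iff i).2 hs).hasSum_iff_tendsto_nat.2 ?_)
  simp only [h1, ← Finset.mul_sum]
  refine Tendsto.const_mul _ ?_
  have h2 := ((tendsto_connector h).comp (tendsto_add_atTop_nat i)).const_sub (connector z k i)
  rw [sub_zero] at h2
  refine h2.congr fun N => ?_
  rw [Finset.sum_range_sub' fun ν => connector z k (ν + i)]
  simp

/-- Transport of a summation over `n ≥ n'`: Fubini for `∑_{n ≥ n'}`. -/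
theorem tsum_connector_partialSums {z : ℂ} {k : ℕ} {s : ℕ → ℝ} (hs0 : ∀ n, 0 ≤ s n)
    (h : 0 < (k : ℝ) + 1 + z.re)
    (hs : Summable fun ν => connector z (k + 1) ν * ((partialSums s ν : ℝ) : ℂ)) :
    (Summable fun ν => connector z k ν * (s ν : ℂ)) ∧
    ∑' ν, connector z (k + 1) ν * ((partialSums s ν : ℝ) : ℂ)
      = shiftMul z (fun k' => ∑' ν, connector z k' ν * (s ν : ℂ)) (k + 1) := by
  have hz : (k : ℂ) + 1 + z ≠ 0 := fun h0 => by
    have := congrArg Complex.re h0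
    simp at this
    linarith
  have hk : (k : ℂ) + 1 ≠ 0 := Nat.cast_add_one_ne_zero k
  let f : ℕ × ℕ → ℂ := fun p => (if p.2 ≤ p.1 then connector z (k + 1) p.1 else 0) * (s p.2 : ℂ)
  have hfin : ∀ ν, ∀ i ∉ Finset.range (ν + 1), f (ν, i) = 0 := by
    intro ν i hi
    simp only [f]
    rw [if_neg (by rw [Finset.mem_range] at hi; omega), zero_mul]
  have hval : ∀ ν, ∀ i ∈ Finset.range (ν + 1), f (ν, i) = connector z (k + 1) ν * (s i : ℂ) := by
    intro ν i hi
    simp only [f]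
    rw [if_pos (by rw [Finset.mem_range] at hi; omega)]
  have hsum : ∀ ν, HasSum (fun i => f (ν, i))
      (connector z (k + 1) ν * ((partialSums s ν : ℝ) : ℂ)) := by
    intro ν
    have := hasSum_sum_of_ne_finset_zero (f := fun i => f (ν, i)) (L := .unconditional ℕ) (hfin ν)
    rwa [Finset.sum_congr rfl (hval ν), ← Finset.mul_sum, ← Complex.ofReal_sum] at this
  have hnorm : ∀ ν, HasSum (fun i => ‖f (ν, i)‖)
      ‖connector z (k + 1) ν * ((partialSums s ν : ℝ) : ℂ)‖ := by
    intro ν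
    have := hasSum_sum_of_ne_finset_zero (f := fun i => ‖f (ν, i)‖) (L := .unconditional ℕ)
      (s := Finset.range (ν + 1)) fun i hi => by rw [hfin ν i hi, norm_zero]
    convert! this using 1
    have hP : ‖partialSums s ν‖ = partialSums s ν :=
      Real.norm_of_nonneg (Finset.sum_nonneg fun i _ => hs0 i)
    rw [norm_mul, Complex.norm_real, hP, partialSums, Finset.mul_sum]
    refine Finset.sum_congr rfl fun i hi => ?_
    rw [hval ν i hi, norm_mul, Complex.norm_real, Real.norm_of_nonneg (hs0 i)]
  have hprod : Summable f := by
    refine Summable.of_norm ((summable_prod_of_nonneg fun p => norm_nonneg _).2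
      ⟨fun ν => (hnorm ν).summable, ?_⟩)
    simp only [(hnorm _).tsum_eq]
    exact hs.norm
  have hinner : ∀ i, ∑' ν, f (ν, i)
      = (k + 1) / (k + 1 + z) * (connector z k i * (s i : ℂ)) := by
    intro i
    by_cases hi : (s i : ℂ) = 0
    · simp [f, hi]
    · have h1 : Summable fun ν => if i ≤ ν then connector z (k + 1) ν else 0 := by
        refine ((hprod.prod_symm.prod_factor i).mul_right (s i : ℂ)⁻¹).congr fun ν => ?_
        simp only [f, Prod.swap, mul_inv_cancel_right₀ hi]
      simp only [f]
      rw [tsum_mul_right, tsum_connector_ge h i h1, mul_assoc]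
  refine ⟨?_, ?_⟩
  · have h1 := hprod.prod_symm.prod
    simp only [Prod.swap, hinner] at h1
    refine (h1.mul_left ((k + 1 + z) / (k + 1))).congr fun i => ?_
    rw [← mul_assoc, div_mul_div_cancel₀ hk, div_self hz, one_mul]
  · calc ∑' ν, connector z (k + 1) ν * ((partialSums s ν : ℝ) : ℂ)
        = ∑' ν, ∑' i, f (ν, i) := tsum_congr fun ν => (hsum ν).tsum_eq.symm
      _ = ∑' i, ∑' ν, f (ν, i) :=
          (Summable.tsum_comm (f := fun ν i => f (ν, i)) hprod).symm
      _ = _ := by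
          simp only [hinner]
          rw [tsum_mul_left, shiftMul, Nat.add_sub_cancel]
          push_cast
          rfl

/-- Transport of `a` divisions by `n`. The hypothesis on `h` concerns only `k' ≥ k + a`, as each
division raises the second variable of the connector by at least `1`. -/
theorem tsum_connector_divSucc_iterate {z : ℂ} (a k : ℕ) {s : ℕ → ℝ} {h : ℕ → ℂ}
    (hs : Summable fun ν => connector z k ν * ((divSucc^[a] s ν : ℝ) : ℂ))
    (hh : ∀ k', k + a ≤ k' → (Summable fun ν => connector z k' ν * (s ν : ℂ)) →
      ∑' ν, connector z k' ν * (s ν : ℂ) = h k') :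
    ∑' ν, connector z k ν * ((divSucc^[a] s ν : ℝ) : ℂ) = upperSum^[a] h k := by
  induction a generalizing k with
  | zero => exact hh k le_rfl hs
  | succ a ih =>
    rw [Function.iterate_succ_apply'] at hs ⊢
    rw [Function.iterate_succ_apply']
    obtain ⟨h1, h2⟩ := tsum_connector_divSucc hs
    rw [h2, upperSum, upperSum]
    refine tsum_congr fun j => ?_
    rw [ih (k + 1 + j) (h1 j) fun k' hk' => hh k' (by omega)]

/-- The sum over all variables `n` against the connector is the iterated series in the variables
`k`. The condition on the first block is what makes all the telescoping series converge. -/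
theorem tsum_connector_harmonicSeq {z : ℂ} (L : List ℕ) (hL : ∀ a ∈ L, 0 < a) (k : ℕ)
    (hk : ∀ a ∈ L.head?, 0 < (k : ℝ) + a + z.re)
    (hs : Summable fun ν => connector z k ν * ((harmonicSeq ℝ L ν : ℝ) : ℂ)) :
    ∑' ν, connector z k ν * ((harmonicSeq ℝ L ν : ℝ) : ℂ) = iteratedSeries z L k := by
  induction L generalizing k with
  | nil =>
    rw [tsum_eq_single 0 fun ν hν => by simp [harmonicSeq, unitSeq, hν], iteratedSeries,
      connector_zero_right]
    simp [harmonicSeq, unitSeq]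
  | cons a L ih =>
    have ha := hL a (by simp)
    have hka := hk a (by simp)
    refine tsum_connector_divSucc_iterate a k hs fun k' hk' hs' => ?_
    obtain ⟨l, rfl⟩ : ∃ l, k' = l + 1 := ⟨k' - 1, by omega⟩
    have hk'' : (k : ℝ) + a ≤ l + 1 := by exact_mod_cast hk'
    obtain ⟨h1, h2⟩ := tsum_connector_partialSums (harmonicSeq_nonneg L) (by linarith) hs'
    rw [h2, shiftMul, shiftMul, Nat.add_sub_cancel,
      ih (fun x hx => hL x (by simp [hx])) l (fun b hb => ?_) h1]
    have hb1 : (1 : ℝ) ≤ b := by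
      exact_mod_cast hL b (List.mem_cons_of_mem _ (List.mem_of_mem_head? hb))
    linarith

/-! ### The multiple series as an iterated series -/

/-- The weight `1 / (x₁ ⋯ xₐ)` of a block `x₁ > ⋯ > xₐ > k`, extended by `0` to all tuples. -/
noncomputable def blockWeight {a : ℕ} (k : ℕ) (x : Fin a → ℕ) : ℂ :=
  open Classical in if (∀ i, k < x i) ∧ StrictAnti x then ∏ i, 1 / (x i : ℂ) else 0

/-- The largest variable of a block lying above `k`; this is `k` for the empty block. -/
def blockTop {a : ℕ} (k : ℕ) (x : Fin a → ℕ) : ℕ := if h : 0 < a then x ⟨0, h⟩ else k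

theorem lt_and_strictAnti_succ_iff {a k : ℕ} (x : Fin (a + 1) → ℕ) :
    ((∀ i, k < x i) ∧ StrictAnti x) ↔ k < x (Fin.last a) ∧
      (∀ i : Fin a, x (Fin.last a) < x i.castSucc) ∧ StrictAnti fun i : Fin a => x i.castSucc := by
  constructor
  · rintro ⟨h1, h2⟩
    exact ⟨h1 _, fun i => h2 (Fin.castSucc_lt_last i),
      fun i j hij => h2 (Fin.castSucc_lt_castSucc_iff.2 hij)⟩
  · rintro ⟨h1, h2, h3⟩
    refine ⟨fun i => ?_, fun i j hij => ?_⟩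
    · induction i using Fin.lastCases with
      | last => exact h1
      | cast i => exact h1.trans (h2 i)
    · induction j using Fin.lastCases with
      | last =>
        induction i using Fin.lastCases with
        | last => exact absurd hij (lt_irrefl _)
        | cast i => exact h2 i
      | cast j =>
        induction i using Fin.lastCases with
        | last => exact absurd hij (Fin.castSucc_lt_last j).asymm
        | cast i => exact h3 (Fin.castSucc_lt_castSucc_iff.1 hij)

theorem blockWeight_succ {a k : ℕ} (x : Fin (a + 1) → ℕ) :
    blockWeight k x = if k < x (Fin.last a) then
      1 / (x (Fin.last a) : ℂ) * blockWeight (x (Fin.last a)) fun i : Fin a => x i.castSucc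
      else 0 := by
  unfold blockWeight
  simp only [lt_and_strictAnti_succ_iff x]
  by_cases h : k < x (Fin.last a)
  · simp only [h, true_and, if_true, Fin.prod_univ_castSucc]
    split_ifs
    · ring
    · simp
  · simp [h]

theorem blockTop_succ {a k : ℕ} (x : Fin (a + 1) → ℕ) :
    blockTop k x = blockTop (x (Fin.last a)) fun i : Fin a => x i.castSucc := by
  rcases Nat.eq_zero_or_pos a with rfl | ha
  · simp [blockTop]
  · simp only [blockTop, ha, Nat.succ_pos, dif_pos]
    rfl

/-- A sum over tuples is a sum over the last coordinate and the others. -/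
theorem tsum_pi_succ {r : ℕ} {X : Fin (r + 1) → Type*}
    {F : X (Fin.last r) → (∀ j : Fin r, X j.castSucc) → ℂ}
    (hF : Summable fun n : ∀ j, X j => F (n (Fin.last r)) fun j => n j.castSucc) :
    (Summable fun p : X (Fin.last r) × (∀ j : Fin r, X j.castSucc) => F p.1 p.2) ∧
    ∑' n : ∀ j, X j, F (n (Fin.last r)) (fun j => n j.castSucc)
      = ∑' x, ∑' n' : ∀ j : Fin r, X j.castSucc, F x n' := by
  have hs : Summable fun p : X (Fin.last r) × (∀ j : Fin r, X j.castSucc) => F p.1 p.2 :=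
    (Fin.snocEquiv X).symm.summable_iff.1 hF
  refine ⟨hs, ?_⟩
  rw [← hs.tsum_prod]
  exact (Fin.snocEquiv X).symm.tsum_eq fun p => F p.1 p.2

theorem tsum_ite_lt (k : ℕ) (u : ℕ → ℂ) (hu : Summable fun y => if k < y then u y else 0) :
    ∑' y, (if k < y then u y else 0) = ∑' j, u (k + 1 + j) := by
  rw [← hu.sum_add_tsum_nat_add (k + 1), Finset.sum_eq_zero fun y hy =>
    if_neg (by rw [Finset.mem_range] at hy; omega), zero_add]
  refine tsum_congr fun j => ?_
  rw [if_pos (by omega), add_comm j]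

theorem tsum_blockWeight_mul {a : ℕ} (k : ℕ) (Φ : ℕ → ℂ)
    (hs : Summable fun x : Fin a → ℕ => blockWeight k x * Φ (blockTop k x)) :
    ∑' x : Fin a → ℕ, blockWeight k x * Φ (blockTop k x) = upperSum^[a] Φ k := by
  induction a generalizing k with
  | zero =>
    rw [tsum_eq_single (fun i => i.elim0) fun x hx => absurd (Subsingleton.elim _ _) hx]
    simp [blockWeight, blockTop, StrictAnti]
  | succ a ih =>
    let F : ℕ → (Fin a → ℕ) → ℂ := fun y x' => (if k < y then 1 / (y : ℂ) else 0)
      * (blockWeight y x' * Φ (blockTop y x'))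
    have hF : ∀ x : Fin (a + 1) → ℕ, blockWeight k x * Φ (blockTop k x)
        = F (x (Fin.last a)) fun i => x i.castSucc := by
      intro x
      simp only [F]
      rw [blockWeight_succ, blockTop_succ]
      split_ifs
      · ring
      · simp
    obtain ⟨hs', htsum⟩ := tsum_pi_succ (X := fun _ : Fin (a + 1) => ℕ) (F := F) (hs.congr hF)
    have hin : ∀ y : ℕ, ∑' x' : Fin a → ℕ, F y x'
        = if k < y then 1 / (y : ℂ) * upperSum^[a] Φ y else 0 := by
      intro y
      simp only [F]
      rw [tsum_mul_left]
      split_ifs with hy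
      · have hy0 : (y : ℂ) ≠ 0 := by exact_mod_cast (by omega : y ≠ 0)
        rw [ih y]
        refine ((hs'.prod_factor y).mul_left (y : ℂ)).congr fun x' => ?_
        simp only [F, if_pos hy]
        rw [← mul_assoc, mul_one_div_cancel hy0, one_mul]
      · simp
    have hout := hs'.prod
    simp only [hin] at hout
    refine (tsum_congr hF).trans (htsum.trans ?_)
    simp only [hin]
    rw [tsum_ite_lt k (fun y => 1 / (y : ℂ) * upperSum^[a] Φ y) hout,
      Function.iterate_succ_apply', upperSum]
    refine tsum_congr fun j => ?_
    push_cast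
    ring

/-- The conditions defining the range of summation of the multiple series, with all variables
`> k`. -/
def IsBlockChain {r : ℕ} {β : Fin r → ℕ} (k : ℕ) (n : (j : Fin r) → Fin (β j) → ℕ) : Prop :=
  (∀ j i, k < n j i) ∧ (∀ j, StrictAnti (n j)) ∧ (∀ j j', j < j' → ∀ i i', n j' i' ≤ n j i)

/-- The first, hence largest, variable of a chain of blocks lying above `k`. The value `k + 1` for
the empty chain makes the recursion uniform. -/
def firstVar {r : ℕ} {β : Fin r → ℕ} (k : ℕ) (n : (j : Fin r) → Fin (β j) → ℕ) : ℕ :=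
  if h : ∃ hr : 0 < r, 0 < β ⟨0, hr⟩ then n ⟨0, h.1⟩ ⟨0, h.2⟩ else k + 1

/-- The term of the multiple series at a chain of blocks, extended by `0` to all families of tuples.
The factor `z / n₁₁` accounts for the first block, as `1 / n - 1 / (n + z) = z / (n (n + z))`. -/
noncomputable def chainTerm {r : ℕ} {β : Fin r → ℕ} (z : ℂ) (k : ℕ)
    (n : (j : Fin r) → Fin (β j) → ℕ) : ℂ :=
  open Classical in
    if IsBlockChain k n then (∏ j, blockP (n j) z) * (z / firstVar k n) else 0

theorem blockP_eq {a : ℕ} (ha : 0 < a) (x : Fin a → ℕ) (z : ℂ) (k : ℕ) (hx : blockTop k x ≠ 0) :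
    blockP x z = (∏ i, 1 / (x i : ℂ)) * (blockTop k x / (blockTop k x + z)) := by
  obtain ⟨b, rfl⟩ : ∃ b, a = b + 1 := ⟨a - 1, by omega⟩
  have h0 : blockTop k x = x 0 := by simp [blockTop]
  rw [h0] at hx ⊢
  have hx' : (x 0 : ℂ) ≠ 0 := by exact_mod_cast hx
  rw [blockP, Fin.prod_univ_succ, Fin.prod_univ_succ]
  simp only [Fin.val_zero, if_true, Fin.val_succ, Nat.add_eq_zero_iff, one_ne_zero, and_false,
    if_false]
  field_simp

theorem isBlockChain_succ_iff {r : ℕ} {β : Fin (r + 1) → ℕ} (hβ : 0 < β (Fin.last r)) (k : ℕ)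
    (n : (j : Fin (r + 1)) → Fin (β j) → ℕ) :
    IsBlockChain k n ↔ ((∀ i, k < n (Fin.last r) i) ∧ StrictAnti (n (Fin.last r))) ∧
      IsBlockChain (blockTop k (n (Fin.last r)) - 1) fun j : Fin r => n j.castSucc := by
  have htop : blockTop k (n (Fin.last r)) = n (Fin.last r) ⟨0, hβ⟩ := dif_pos hβ
  rw [htop]
  constructor
  · rintro ⟨h1, h2, h3⟩
    refine ⟨⟨h1 _, h2 _⟩, fun j i => ?_, fun j => h2 _,
      fun j j' hj => h3 _ _ (Fin.castSucc_lt_castSucc_iff.2 hj)⟩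
    have h4 := h3 _ _ (Fin.castSucc_lt_last j) i ⟨0, hβ⟩
    have h5 := h1 _ ⟨0, hβ⟩
    change _ < n j.castSucc i
    omega
  · rintro ⟨⟨h1, h2⟩, h3, h4, h5⟩
    refine ⟨fun j i => ?_, fun j => ?_, fun j j' hj => ?_⟩
    · induction j using Fin.lastCases with
      | last => exact h1 i
      | cast j =>
        have h6 : _ < n j.castSucc i := h3 j i
        have h7 := h1 ⟨0, hβ⟩
        omega
    · induction j using Fin.lastCases with
      | last => exact h2
      | cast j => exact h4 j
    · induction j using Fin.lastCases with
      | last => exact absurd hj (Fin.le_last j').not_gt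
      | cast j =>
        induction j' using Fin.lastCases with
        | last =>
          intro i i'
          have h6 : _ < n j.castSucc i := h3 j i
          have h7 : n (Fin.last r) i' ≤ n (Fin.last r) ⟨0, hβ⟩ :=
            h2.antitone (Fin.le_def.2 (Nat.zero_le _))
          omega
        | cast j' => exact h5 j j' (Fin.castSucc_lt_castSucc_iff.1 hj)

theorem chainTerm_succ {r : ℕ} {β : Fin (r + 1) → ℕ} (hβ : ∀ j, 0 < β j) (z : ℂ) (k : ℕ)
    (n : (j : Fin (r + 1)) → Fin (β j) → ℕ) :
    chainTerm z k n = blockWeight k (n (Fin.last r))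
      * ((blockTop k (n (Fin.last r)) : ℂ) / (blockTop k (n (Fin.last r)) + z))
      * chainTerm z (blockTop k (n (Fin.last r)) - 1) fun j : Fin r => n j.castSucc := by
  have htop : blockTop k (n (Fin.last r)) = n (Fin.last r) ⟨0, hβ _⟩ := dif_pos (hβ _)
  have hchain := isBlockChain_succ_iff (hβ (Fin.last r)) k n
  unfold chainTerm blockWeight
  by_cases h1 : (∀ i, k < n (Fin.last r) i) ∧ StrictAnti (n (Fin.last r))
  · have hpos : blockTop k (n (Fin.last r)) ≠ 0 := by
      rw [htop]; have := h1.1 ⟨0, hβ _⟩; omega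
    have hfirst : firstVar k n
        = firstVar (blockTop k (n (Fin.last r)) - 1) fun j : Fin r => n j.castSucc := by
      rcases Nat.eq_zero_or_pos r with rfl | hr
      · have h2 : ∃ hr : 0 < 0 + 1, 0 < β ⟨0, hr⟩ := ⟨Nat.one_pos, hβ _⟩
        rw [firstVar, dif_pos h2, firstVar, dif_neg (fun h => h.1.false), Nat.sub_add_cancel
          (Nat.pos_of_ne_zero hpos), htop]
        rfl
      · have h2 : ∃ hr : 0 < r + 1, 0 < β ⟨0, hr⟩ := ⟨r.succ_pos, hβ _⟩
        have h3 : ∃ h : 0 < r, 0 < β (Fin.castSucc ⟨0, h⟩) := ⟨hr, hβ _⟩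
        rw [firstVar, dif_pos h2, firstVar, dif_pos h3]
        rfl
    rw [if_pos h1]
    by_cases h2 : IsBlockChain (blockTop k (n (Fin.last r)) - 1) fun j : Fin r => n j.castSucc
    · rw [if_pos h2, if_pos (hchain.2 ⟨h1, h2⟩), Fin.prod_univ_castSucc,
        blockP_eq (hβ (Fin.last r)) (n (Fin.last r)) z k hpos, hfirst]
      ring
    · rw [if_neg h2, if_neg fun h => h2 (hchain.1 h).2, mul_zero]
  · rw [if_neg h1, if_neg fun h => h1 (hchain.1 h).1, zero_mul, zero_mul]

theorem tsum_chainTerm {r : ℕ} {β : Fin r → ℕ} (hβ : ∀ j, 0 < β j) (z : ℂ) (k : ℕ)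
    (hs : Summable (chainTerm (β := β) z k)) :
    ∑' n, chainTerm (β := β) z k n = iteratedSeries z (List.ofFn β).reverse k := by
  induction r generalizing k with
  | zero =>
    rw [tsum_eq_single (fun j => j.elim0) fun x hx => absurd (Subsingleton.elim _ _) hx]
    simp [chainTerm, IsBlockChain, firstVar, iteratedSeries]
  | succ r ih =>
    let F : (Fin (β (Fin.last r)) → ℕ) → ((j : Fin r) → Fin (β j.castSucc) → ℕ) → ℂ :=
      fun x n' => blockWeight k x * ((blockTop k x : ℂ) / (blockTop k x + z))
        * chainTerm z (blockTop k x - 1) n'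
    obtain ⟨hs', htsum⟩ := tsum_pi_succ (X := fun j => Fin (β j) → ℕ) (F := F)
      (hs.congr fun n => chainTerm_succ hβ z k n)
    refine (tsum_congr fun n => chainTerm_succ hβ z k n).trans (htsum.trans ?_)
    have hin : ∀ x : Fin (β (Fin.last r)) → ℕ,
        ∑' n' : (j : Fin r) → Fin (β j.castSucc) → ℕ, F x n'
        = blockWeight k x * shiftMul z
            (iteratedSeries z (List.ofFn fun j : Fin r => β j.castSucc).reverse)
            (blockTop k x) := by
      intro x
      simp only [F]
      rw [tsum_mul_left, shiftMul, ← mul_assoc]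
      by_cases h0 : blockWeight k x * ((blockTop k x : ℂ) / (blockTop k x + z)) = 0
      · rw [h0, zero_mul, zero_mul]
      · rw [ih (fun j => hβ _)]
        exact (summable_mul_left_iff h0).1 (hs'.prod_factor x)
    have hout := hs'.prod
    simp only [hin] at hout ⊢
    rw [tsum_blockWeight_mul k _ hout, List.ofFn_succ', List.concat_eq_append, List.reverse_append,
      List.reverse_singleton, List.singleton_append, iteratedSeries]

/-! ### Absolute convergence of the multiple series -/

theorem summable_prod_pi {ι : Type*} [Fintype ι] {X : ι → Type*} {f : ∀ i, X i → ℝ}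
    (hf0 : ∀ i x, 0 ≤ f i x) (hf : ∀ i, Summable (f i)) :
    Summable fun x : ∀ i, X i => ∏ i, f i (x i) := by
  classical
  refine summable_of_sum_le (c := ∏ i, ∑' x, f i x)
    (fun x => Finset.prod_nonneg fun i _ => hf0 i _) fun u => ?_
  calc ∑ x ∈ u, ∏ i, f i (x i)
      ≤ ∑ x ∈ Fintype.piFinset fun i => u.image fun x => x i, ∏ i, f i (x i) := by
        refine Finset.sum_le_sum_of_subset_of_nonneg (fun x hx => ?_)
          fun x _ _ => Finset.prod_nonneg fun i _ => hf0 i _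
        exact Fintype.mem_piFinset.2 fun i => Finset.mem_image_of_mem _ hx
    _ = ∏ i, ∑ x ∈ u.image fun x => x i, f i x := (Finset.prod_univ_sum _ _).symm
    _ ≤ _ := Finset.prod_le_prod (fun i _ => Finset.sum_nonneg fun x _ => hf0 i x)
        fun i _ => (hf i).sum_le_tsum _ fun x _ => hf0 i x

/-- The largest of `a` distinct positive integers is at least `a`. -/
theorem le_of_strictAnti {a : ℕ} {x : Fin a → ℕ} (hx : StrictAnti x) (h0 : ∀ i, 0 < x i)
    (ha : 0 < a) : a ≤ x ⟨0, ha⟩ := by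
  have := Finset.card_le_card_of_injOn (s := Finset.univ) (t := Finset.Icc 1 (x ⟨0, ha⟩)) x
    (fun i _ => Finset.mem_coe.2 (Finset.mem_Icc.2
      ⟨h0 i, hx.antitone (Fin.le_def.2 (Nat.zero_le _))⟩)) hx.injective.injOn
  simpa using this

theorem exists_le_mul_norm_add {a : ℕ} {z : ℂ} (h : 0 < (a : ℝ) + z.re) :
    ∃ C : ℝ, 0 < C ∧ ∀ n : ℕ, a ≤ n → (n : ℝ) ≤ C * ‖(n : ℂ) + z‖ := by
  have hle : ∀ n : ℕ, (n : ℝ) + z.re ≤ ‖(n : ℂ) + z‖ := fun n => by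
    simpa using Complex.re_le_norm ((n : ℂ) + z)
  rcases le_or_gt 0 z.re with hz | hz
  · exact ⟨1, one_pos, fun n _ => by linarith [hle n]⟩
  · refine ⟨a / (a + z.re), div_pos (by linarith) h, fun n hn => ?_⟩
    have hn' : (a : ℝ) ≤ n := by exact_mod_cast hn
    rw [div_mul_eq_mul_div, le_div_iff₀ h]
    nlinarith [hle n, mul_le_mul_of_nonneg_left (hle n) (Nat.cast_nonneg a : (0 : ℝ) ≤ a)]

theorem norm_blockP_le {a : ℕ} (ha : 0 < a) {x : Fin a → ℕ} {z : ℂ} {C : ℝ}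
    (hx : ∀ i, 0 < x i) (hC : (x ⟨0, ha⟩ : ℝ) ≤ C * ‖(x ⟨0, ha⟩ : ℂ) + z‖) :
    ‖blockP x z‖ ≤ C * ∏ i, 1 / (x i : ℝ) := by
  have htop : blockTop 0 x = x ⟨0, ha⟩ := dif_pos ha
  have hx0 : (0 : ℝ) < x ⟨0, ha⟩ := by exact_mod_cast hx _
  have hz : 0 < ‖(x ⟨0, ha⟩ : ℂ) + z‖ := by
    rcases (norm_nonneg ((x ⟨0, ha⟩ : ℂ) + z)).eq_or_lt with h | h
    · rw [← h, mul_zero] at hC; linarith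
    · exact h
  rw [blockP_eq ha x z 0 (by rw [htop]; exact (hx _).ne'), htop, norm_mul, norm_div, norm_prod,
    mul_comm]
  simp only [norm_div, norm_one, Complex.norm_natCast]
  refine mul_le_mul_of_nonneg_right ?_ (Finset.prod_nonneg fun i _ => by positivity)
  rwa [div_le_iff₀ hz]

theorem IsBlockChain.le_first {r : ℕ} {β : Fin r → ℕ} (hβ : ∀ j, 0 < β j) {k : ℕ}
    {n : (j : Fin r) → Fin (β j) → ℕ} (hn : IsBlockChain k n) (j j' : Fin r) (hj : j ≤ j')
    (i : Fin (β j')) : n j' i ≤ n j ⟨0, hβ j⟩ := by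
  rcases hj.eq_or_lt with rfl | hj
  · exact (hn.2.1 j).antitone (Fin.le_def.2 (Nat.zero_le _))
  · exact hn.2.2 j j' hj _ _

theorem IsBlockChain.le_firstVar {r : ℕ} {β : Fin (r + 1) → ℕ} (hβ : ∀ j, 0 < β j) {k : ℕ}
    {n : (j : Fin (r + 1)) → Fin (β j) → ℕ} (hn : IsBlockChain k n) (j : Fin (r + 1))
    (i : Fin (β j)) : n j i ≤ firstVar k n := by
  rw [firstVar, dif_pos ⟨r.succ_pos, hβ _⟩]
  exact hn.le_first hβ ⟨0, r.succ_pos⟩ j (Fin.zero_le j) i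

/-- The multiple series converges absolutely. As the first variable is the largest, the extra
factor `1 / n₁₁` can be distributed over all `N` variables, which leaves a product of convergent
series `∑ n ^ (-1 - 1 / N)`. -/
theorem summable_chainTerm {r : ℕ} {β : Fin (r + 1) → ℕ} (hβ : ∀ j, 0 < β j) {z : ℂ}
    (h : 0 < (β (Fin.last r) : ℝ) + z.re) : Summable (chainTerm (β := β) z 0) := by
  obtain ⟨C, hC0, hC⟩ := exists_le_mul_norm_add h
  set N : ℕ := ∑ j, β j with hN
  have hN0 : 0 < N := Finset.sum_pos (fun j _ => hβ j) Finset.univ_nonempty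
  have hN0' : (0 : ℝ) < N := by exact_mod_cast hN0
  have hsum : Summable fun n : (j : Fin (r + 1)) → Fin (β j) → ℕ =>
      ‖z‖ * C ^ (r + 1) * ∏ j, ∏ i, (n j i : ℝ) ^ (-1 - 1 / (N : ℝ)) := by
    refine Summable.mul_left _ (summable_prod_pi (X := fun j => Fin (β j) → ℕ)
      (f := fun j x => ∏ i, (x i : ℝ) ^ (-1 - 1 / (N : ℝ)))
      (fun j x => Finset.prod_nonneg fun i _ => by positivity) fun j => ?_)
    refine summable_prod_pi (X := fun _ => ℕ) (f := fun _ x => (x : ℝ) ^ (-1 - 1 / (N : ℝ)))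
      (fun i x => by positivity) fun i => Real.summable_nat_rpow.2 ?_
    have : 0 < 1 / (N : ℝ) := by positivity
    linarith
  refine hsum.of_norm_bounded fun n => ?_
  unfold chainTerm
  split_ifs with hn
  swap
  · rw [norm_zero]; positivity
  have hpos : ∀ j i, (0 : ℝ) < n j i := fun j i => by exact_mod_cast hn.1 j i
  have hfirst : (0 : ℝ) < firstVar 0 n :=
    (hpos 0 ⟨0, hβ 0⟩).trans_le (by exact_mod_cast hn.le_firstVar hβ 0 _)
  have hblock : ∀ j, ‖blockP (n j) z‖ ≤ C * ∏ i, 1 / (n j i : ℝ) := by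
    intro j
    refine norm_blockP_le (hβ j) (hn.1 j) (hC _ ?_)
    exact (le_of_strictAnti (hn.2.1 (Fin.last r)) (hn.1 _) (hβ _)).trans
      (hn.le_first hβ j _ (Fin.le_last j) _)
  have hdist : 1 / (firstVar 0 n : ℝ) ≤ ∏ j, ∏ i, (n j i : ℝ) ^ (-(1 / (N : ℝ))) := by
    calc 1 / (firstVar 0 n : ℝ)
        = ∏ j, ∏ _i : Fin (β j), (firstVar 0 n : ℝ) ^ (-(1 / (N : ℝ))) := by
          simp only [Finset.prod_const, Finset.card_univ, Fintype.card_fin]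
          rw [Finset.prod_pow_eq_pow_sum, ← hN, ← Real.rpow_natCast, ← Real.rpow_mul hfirst.le,
            neg_mul, one_div_mul_cancel hN0'.ne', Real.rpow_neg_one, one_div]
      _ ≤ _ := by
          refine Finset.prod_le_prod (fun j _ => by positivity) fun j _ =>
            Finset.prod_le_prod (fun i _ => by positivity) fun i _ => ?_
          refine Real.rpow_le_rpow_of_nonpos (hpos j i) ?_ (by simp)
          exact_mod_cast hn.le_firstVar hβ j i
  rw [norm_mul, norm_div, Complex.norm_natCast, norm_prod]
  calc (∏ j, ‖blockP (n j) z‖) * (‖z‖ / (firstVar 0 n : ℝ))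
      ≤ (∏ j, C * ∏ i, 1 / (n j i : ℝ)) * (‖z‖ * ∏ j, ∏ i, (n j i : ℝ) ^ (-(1 / (N : ℝ)))) := by
        rw [div_eq_mul_one_div]
        gcongr with j
        exact hblock j
    _ = ‖z‖ * C ^ (r + 1)
          * ∏ j, ∏ i, (1 / (n j i : ℝ) * (n j i : ℝ) ^ (-(1 / (N : ℝ)))) := by
        simp only [Finset.prod_mul_distrib, Finset.prod_const, Finset.card_univ, Fintype.card_fin]
        ring
    _ = _ := by
        congr 1
        refine Finset.prod_congr rfl fun j _ => Finset.prod_congr rfl fun i _ => ?_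
        rw [sub_eq_add_neg, Real.rpow_add (hpos j i), Real.rpow_neg_one, one_div]

theorem prod_block_eq {r : ℕ} {β : Fin (r + 1) → ℕ} (hβ : ∀ j, 0 < β j) {z : ℂ}
    (n : (j : Fin (r + 1)) → Fin (β j) → ℕ) (h0 : firstVar 0 n ≠ 0)
    (hz : (firstVar 0 n : ℂ) + z ≠ 0) :
    (∏ j : Fin (r + 1), if (j : ℕ) = 0 then blockPTilde (n j) z else blockP (n j) z)
      = (∏ j, blockP (n j) z) * (z / firstVar 0 n) := by
  have hfirst : firstVar 0 n = n 0 ⟨0, hβ 0⟩ := dif_pos ⟨r.succ_pos, hβ _⟩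
  have hblock : blockPTilde (n 0) z = blockP (n 0) z * (z / firstVar 0 n) := by
    generalize n 0 = x at hfirst ⊢
    rw [hfirst] at h0 hz ⊢
    generalize hβ 0 = hb at x h0 hz ⊢
    clear hfirst
    generalize β 0 = b at x hb h0 hz ⊢
    obtain ⟨c, rfl⟩ : ∃ c, b = c + 1 := ⟨b - 1, by omega⟩
    have h0' : (x ⟨0, hb⟩ : ℂ) ≠ 0 := by exact_mod_cast h0
    rw [blockPTilde, blockP, Fin.prod_univ_succ, Fin.prod_univ_succ]
    simp only [Fin.val_zero, if_true, Fin.val_succ, Nat.add_eq_zero_iff, one_ne_zero, and_false,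
      if_false]
    change (1 / (x ⟨0, hb⟩ : ℂ) - 1 / ((x ⟨0, hb⟩ : ℂ) + z)) * _
      = 1 / ((x ⟨0, hb⟩ : ℂ) + z) * _ * _
    field_simp
    ring
  rw [Fin.prod_univ_succ, Fin.prod_univ_succ]
  simp only [Fin.val_zero, if_true, Fin.val_succ, Nat.add_eq_zero_iff, one_ne_zero, and_false,
    if_false, hblock]
  ring

/-- The multiple series converges absolutely, with sum the iterated series. -/
theorem hasSum_blockChain {r : ℕ} (hr : 0 < r) {β : Fin r → ℕ} (hβ : ∀ j, 0 < β j) {z : ℂ}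
    (h : ∀ a ∈ (List.ofFn β).reverse.head?, 0 < (a : ℝ) + z.re) :
    HasSum (fun n : {n : (j : Fin r) → Fin (β j) → ℕ // IsBlockChain 0 n} =>
      ∏ j : Fin r, if (j : ℕ) = 0 then blockPTilde (n.1 j) z else blockP (n.1 j) z)
      (iteratedSeries z (List.ofFn β).reverse 0) := by
  obtain ⟨r, rfl⟩ : ∃ q, r = q + 1 := ⟨r - 1, by omega⟩
  have hlast : 0 < (β (Fin.last r) : ℝ) + z.re := h _ (by
    rw [List.ofFn_succ', List.concat_eq_append, List.reverse_append]; simp)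
  have hs := summable_chainTerm hβ hlast
  have hsum := hs.hasSum
  rw [tsum_chainTerm hβ z 0 hs] at hsum
  have hterm : ∀ n : {n : (j : Fin (r + 1)) → Fin (β j) → ℕ // IsBlockChain 0 n},
      (∏ j : Fin (r + 1), if (j : ℕ) = 0 then blockPTilde (n.1 j) z else blockP (n.1 j) z)
        = chainTerm z 0 n.1 := by
    rintro ⟨n, hn⟩
    have h1 : β (Fin.last r) ≤ firstVar 0 n :=
      (le_of_strictAnti (hn.2.1 (Fin.last r)) (hn.1 _) (hβ _)).trans (hn.le_firstVar hβ _ _)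
    have h2 := hβ (Fin.last r)
    rw [chainTerm, if_pos hn, prod_block_eq hβ n (by omega)]
    intro h0
    have h3 := congrArg Complex.re h0
    have h4 : (β (Fin.last r) : ℝ) ≤ firstVar 0 n := by exact_mod_cast h1
    simp only [Complex.add_re, Complex.natCast_re, Complex.zero_re] at h3
    linarith
  simp only [hterm]
  refine (hasSum_subtype_iff_of_support_subset (s := {n | IsBlockChain 0 n}) fun n hn => ?_).2 hsum
  by_contra hn'
  exact hn (if_neg hn')

theorem hasSum_multipleTerm {m : ℕ} (hm : 0 < m) (β : Composition m) {z : ℂ}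
    (h : ∀ a ∈ β.blocks.reverse.head?, 0 < (a : ℝ) + z.re) :
    HasSum (multipleTerm β z) (iteratedSeries z β.blocks.reverse 0) := by
  have := hasSum_blockChain (β.length_pos_of_pos hm) (β := β.blocksFun) (z := z)
    (fun j => β.blocks_pos' j j.2) (by rwa [β.ofFn_blocksFun])
  rw [β.ofFn_blocksFun] at this
  exact this

/-! ### Divergence to the left of the abscissa -/

/-- If a Newton series converges at `z`, its partial sums are bounded at every negative real
`x > Re z`. The ratios `binom(x, n) / binom(z, n)` have bounded variation, which is controlled by
the telescoping products `∏ (i - x) / (i - Re z)`. -/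
theorem newtonPartialSum_bounded {a : ℕ → ℂ} {z w : ℂ} {x : ℝ} (hzx : z.re < x) (hx : x < 0)
    (hw : HasNewtonSum a z w) : ∃ M, ∀ N, ‖newtonPartialSum a x N‖ ≤ M := by
  obtain ⟨M, hM⟩ : ∃ M, ∀ N, ‖newtonPartialSum a z N‖ ≤ M := by
    obtain ⟨M, hM⟩ := (Metric.isBounded_range_of_tendsto _ hw).exists_norm_le
    exact ⟨M, fun N => hM _ ⟨N, rfl⟩⟩
  have hM0 : 0 ≤ M := (norm_nonneg _).trans (hM 0)
  let r : ℕ → ℂ := fun n => ∏ i ∈ Finset.range n, ((x : ℂ) - i) / (z - i)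
  let R : ℕ → ℝ := fun n => ∏ i ∈ Finset.range n, ((i : ℝ) - x) / (i - z.re)
  have hσ : ∀ i : ℕ, 0 < (i : ℝ) - z.re := fun i => by
    have : (0 : ℝ) ≤ i := Nat.cast_nonneg i
    linarith
  have hix : ∀ i : ℕ, 0 < (i : ℝ) - x := fun i => by
    have : (0 : ℝ) ≤ i := Nat.cast_nonneg i
    linarith
  have hnorm : ∀ i : ℕ, (i : ℝ) - z.re ≤ ‖z - i‖ := fun i => by
    rw [norm_sub_rev]
    simpa using Complex.re_le_norm ((i : ℂ) - z)
  have hz : ∀ i : ℕ, z - i ≠ 0 := fun i => norm_pos_iff.1 ((hσ i).trans_le (hnorm i))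
  have hR0 : ∀ n, 0 ≤ R n := fun n =>
    Finset.prod_nonneg fun i _ => div_nonneg (hix i).le (hσ i).le
  have hrR : ∀ n, ‖r n‖ ≤ R n := fun n => by
    simp only [r, R, norm_prod]
    refine Finset.prod_le_prod (fun i _ => norm_nonneg _) fun i _ => ?_
    have h1 : ‖(x : ℂ) - i‖ = i - x := by
      rw [norm_sub_rev, ← Complex.ofReal_natCast, ← Complex.ofReal_sub, Complex.norm_real,
        Real.norm_of_nonneg (hix i).le]
    rw [norm_div, h1]
    exact div_le_div_of_nonneg_left (hix i).le (hσ i) (hnorm i)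
  have hbinom : ∀ n, complexBinom x n = complexBinom z n * r n := fun n => by
    have : ∏ i ∈ Finset.range n, ((x : ℂ) - i) = (∏ i ∈ Finset.range n, (z - (i : ℂ))) * r n := by
      simp only [r, ← Finset.prod_mul_distrib]
      exact Finset.prod_congr rfl fun i _ => (mul_div_cancel₀ _ (hz i)).symm
    rw [complexBinom, complexBinom, this]
    ring
  set K : ℝ := ‖(x : ℂ) - z‖ / (x - z.re) with hK
  have hK0 : 0 ≤ K := div_nonneg (norm_nonneg _) (by linarith)
  have hvar : ∀ n, ‖r n - r (n + 1)‖ ≤ K * (R n - R (n + 1)) := fun n => by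
    have h1 : r n - r (n + 1) = -(r n * (((x : ℂ) - z) / (z - n))) := by
      simp only [r, Finset.prod_range_succ]
      have := hz n
      field_simp
      ring
    have h2 : R n - R (n + 1) = R n * ((x - z.re) / (n - z.re)) := by
      simp only [R, Finset.prod_range_succ]
      have := (hσ n).ne'
      field_simp
      ring
    have h3 : K * ((x - z.re) / (n - z.re)) = ‖(x : ℂ) - z‖ / (n - z.re) := by
      rw [hK, div_mul_div_cancel₀ (by linarith)]
    rw [h1, norm_neg, norm_mul, norm_div, h2, mul_left_comm, h3]
    exact mul_le_mul (hrR n) (div_le_div_of_nonneg_left (norm_nonneg _) (hσ n) (hnorm n))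
      (by positivity) (hR0 n)
  -- Summation by parts, one step at a time.
  have key : ∀ N, ‖newtonPartialSum a x N - newtonPartialSum a z N * r N‖
      ≤ M * K * (1 - R N) := by
    intro N
    induction N with
    | zero => simp [newtonPartialSum, R]
    | succ N ih =>
      have h1 : newtonPartialSum a x (N + 1) - newtonPartialSum a z (N + 1) * r (N + 1)
          = (newtonPartialSum a x N - newtonPartialSum a z N * r N)
            + newtonPartialSum a z (N + 1) * (r N - r (N + 1)) := by
        simp only [newtonPartialSum, Finset.sum_range_succ, hbinom]
        ring
      calc _ ≤ M * K * (1 - R N) + M * (K * (R N - R (N + 1))) := by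
            rw [h1]
            refine (norm_add_le _ _).trans (add_le_add ih ?_)
            rw [norm_mul]
            exact mul_le_mul (hM _) (hvar N) (norm_nonneg _) hM0
        _ = _ := by ring
  have hR1 : ∀ n, R n ≤ 1 := fun n => Finset.prod_le_one
    (fun i _ => div_nonneg (hix i).le (hσ i).le)
    fun i _ => (div_le_one (hσ i)).2 (by linarith)
  refine ⟨M + M * K, fun N => ?_⟩
  calc ‖newtonPartialSum a x N‖
      = ‖newtonPartialSum a z N * r N
          + (newtonPartialSum a x N - newtonPartialSum a z N * r N)‖ := by congr 1; ring
    _ ≤ M * 1 + M * K * 1 := by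
        refine (norm_add_le _ _).trans (add_le_add ?_ ((key N).trans ?_))
        · rw [norm_mul]
          exact mul_le_mul (hM N) ((hrR N).trans (hR1 N)) (norm_nonneg _) hM0
        · exact mul_le_mul_of_nonneg_left (by linarith [hR0 N]) (mul_nonneg hM0 hK0)
    _ = _ := by ring

theorem harmonicSeq_zero_right (L : List ℕ) : harmonicSeq ℝ L 0 = 1 := by
  induction L with
  | nil => rfl
  | cons a L ih => simp [harmonicSeq, divSucc_iterate_apply, partialSums, ih]

theorem one_div_pow_le_harmonicSeq (a : ℕ) (L : List ℕ) (ν : ℕ) :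
    1 / ((ν : ℝ) + 1) ^ a ≤ harmonicSeq ℝ (a :: L) ν := by
  rw [harmonicSeq, divSucc_iterate_apply]
  have : harmonicSeq ℝ L 0 ≤ partialSums (harmonicSeq ℝ L) ν :=
    Finset.single_le_sum (f := harmonicSeq ℝ L) (fun i _ => harmonicSeq_nonneg L i)
      (Finset.mem_range.2 ν.succ_pos)
  rw [harmonicSeq_zero_right] at this
  gcongr

/-- At a real `x ≤ -(b + 1)` the coefficients `(-1)ⁿ binom(x, n)` are at least `n ^ b / b!`. -/
theorem newtonTerm_ofReal {x : ℝ} {b : ℕ} (hx : x ≤ -((b : ℝ) + 1)) (ν : ℕ) :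
    ∃ p : ℝ, newtonTerm x ν = ((-p : ℝ) : ℂ) ∧ ((ν : ℝ) + 1) ^ b / b ! ≤ p := by
  refine ⟨(∏ i ∈ Finset.range (ν + 1), ((i : ℝ) - x)) / (ν + 1)!, ?_, ?_⟩
  · have h1 : ∏ i ∈ Finset.range (ν + 1), ((x : ℂ) - i)
        = (-1) ^ (ν + 1) * ∏ i ∈ Finset.range (ν + 1), ((i : ℂ) - x) := by
      rw [← Finset.card_range (ν + 1), ← Finset.prod_const, Finset.card_range,
        ← Finset.prod_mul_distrib]
      exact Finset.prod_congr rfl fun i _ => by ring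
    have h2 : (-1 : ℂ) ^ ν * (-1) ^ ν = 1 := by rw [← mul_pow]; simp
    rw [newtonTerm, complexBinom, h1]
    push_cast
    rw [pow_succ]
    linear_combination (-(∏ i ∈ Finset.range (ν + 1), ((i : ℂ) - x)) / ((ν + 1)! : ℂ)) * h2
  · have h1 : ((b + 1).ascFactorial (ν + 1) : ℝ) ≤ ∏ i ∈ Finset.range (ν + 1), ((i : ℝ) - x) := by
      rw [Nat.ascFactorial_eq_prod_range]
      push_cast
      exact Finset.prod_le_prod (fun i _ => by positivity) fun i _ => by linarith
    have h2 : ((b ! * (b + 1).ascFactorial (ν + 1) : ℕ) : ℝ) = ((ν + 1 + b)! : ℕ) := by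
      rw [Nat.factorial_mul_ascFactorial, add_comm b]
    have h3 : (((ν + 1)! * (ν + 1 + 1) ^ b : ℕ) : ℝ) ≤ ((ν + 1 + b)! : ℕ) := by
      exact_mod_cast Nat.factorial_mul_pow_le_factorial
    rw [div_le_div_iff₀ (by positivity) (by positivity)]
    have h4 : ((ν : ℝ) + 1) ^ b ≤ (ν + 1 + 1) ^ b := by gcongr; linarith
    push_cast at h2 h3
    calc ((ν : ℝ) + 1) ^ b * (ν + 1)! ≤ (ν + 1)! * (ν + 1 + 1) ^ b := by
          rw [mul_comm]; gcongr
      _ ≤ b ! * (b + 1).ascFactorial (ν + 1) := by rw [h2]; exact h3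
      _ ≤ _ := by rw [mul_comm]; gcongr

/-- To the left of `-(b + 1)` all terms have the same sign, and they dominate the harmonic
series. -/
theorem not_bounded_sum_newtonTerm_mul_harmonicSeq {x : ℝ} {b : ℕ} (hx : x ≤ -((b : ℝ) + 1))
    (L : List ℕ) : ¬ ∃ M, ∀ N, ‖∑ ν ∈ Finset.range N,
      newtonTerm x ν * ((harmonicSeq ℝ ((b + 1) :: L) ν : ℝ) : ℂ)‖ ≤ M := by
  rintro ⟨M, hM⟩
  choose p hp hpb using newtonTerm_ofReal hx
  have hterm : ∀ ν : ℕ, 1 / (b ! : ℝ) * (1 / ((ν : ℝ) + 1))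
      ≤ p ν * harmonicSeq ℝ ((b + 1) :: L) ν := by
    intro ν
    have h1 := one_div_pow_le_harmonicSeq (b + 1) L ν
    calc 1 / (b ! : ℝ) * (1 / ((ν : ℝ) + 1))
        = ((ν : ℝ) + 1) ^ b / b ! * (1 / ((ν : ℝ) + 1) ^ (b + 1)) := by field_simp; ring
      _ ≤ _ := mul_le_mul (hpb ν) h1 (by positivity) ((by positivity : (0 : ℝ) ≤ _).trans (hpb ν))
  have hle : ∀ N, 1 / (b ! : ℝ) * ∑ ν ∈ Finset.range N, 1 / ((ν : ℝ) + 1) ≤ M := by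
    intro N
    refine le_trans ?_ (hM N)
    have h1 : ∑ ν ∈ Finset.range N, newtonTerm x ν * ((harmonicSeq ℝ ((b + 1) :: L) ν : ℝ) : ℂ)
        = ((-∑ ν ∈ Finset.range N, p ν * harmonicSeq ℝ ((b + 1) :: L) ν : ℝ) : ℂ) := by
      push_cast
      rw [← Finset.sum_neg_distrib]
      exact Finset.sum_congr rfl fun ν _ => by rw [hp]; push_cast; ring
    rw [h1, Complex.norm_real, norm_neg, Finset.mul_sum]
    exact (Finset.sum_le_sum fun ν _ => hterm ν).trans (le_abs_self _)
  have hdiv := Real.tendsto_sum_range_one_div_nat_succ_atTop.const_mul_atTop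
    (by positivity : (0 : ℝ) < 1 / (b ! : ℝ))
  obtain ⟨N, hN⟩ := (hdiv.eventually_gt_atTop M).exists
  exact absurd (hle N) (not_le.2 hN)

/-! ### The Newton series of a finite multiple harmonic sum -/

theorem newtonPartialSum_harmonicSum {m : ℕ} (hm : 0 < m) (α : Composition m) (z : ℂ) (N : ℕ) :
    newtonPartialSum (harmonicSum α) z (N + 1) = ∑ ν ∈ Finset.range N,
      newtonTerm z ν * ((harmonicSeq ℝ (hoffmanDual α).blocks ν : ℝ) : ℂ) := by
  rw [newtonPartialSum, Finset.sum_range_succ', invOp_harmonicSum_zero hm, mul_zero, zero_mul,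
    add_zero]
  refine Finset.sum_congr rfl fun ν _ => ?_
  rw [invOp_harmonicSum_succ hm, harmonicSeq_ofReal, newtonTerm]
  ring

theorem hasNewtonSum_harmonicSum {m : ℕ} (hm : 0 < m) (α : Composition m) {a : ℕ} {L : List ℕ}
    (hL : (hoffmanDual α).blocks = a :: L) {z : ℂ} (h : 0 < (a : ℝ) + z.re) :
    Summable (multipleTerm (reversedDual α) z) ∧
      HasNewtonSum (harmonicSum α) z (multipleSeries (reversedDual α) z) := by
  have hrev : (reversedDual α).blocks.reverse = a :: L := by
    rw [reversedDual, Composition.reverse, List.reverse_reverse, hL]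
  have hpos : ∀ b ∈ a :: L, 0 < b := fun b hb => (hoffmanDual α).blocks_pos (hL ▸ hb)
  have hG := hasSum_multipleTerm hm (reversedDual α) (z := z) (by rw [hrev]; simpa using h)
  refine ⟨hG.summable, ?_⟩
  have hs := summable_newtonTerm_mul_harmonicSeq (z := z) (a := a) (L := L)
    (fun b hb => hpos b (by simp [hb])) h
  have hF := tsum_connector_harmonicSeq (z := z) (a :: L) hpos 0 (by simpa using h)
    (by simpa only [connector_zero_left] using hs)
  simp only [connector_zero_left] at hF
  rw [multipleSeries, hG.tsum_eq, hrev, ← hF]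
  refine (tendsto_add_atTop_iff_nat 1).1 ?_
  simp only [newtonPartialSum_harmonicSum hm, hL]
  exact hs.hasSum.tendsto_sum_nat

theorem theorem3p40 {m : ℕ} (hm : 0 < m) (α : Composition m) (a₁ : ℕ)
    (ha₁ : a₁ = (hoffmanDual α).blocksFun ⟨0, (hoffmanDual α).length_pos_of_pos hm⟩) :
    IsNewtonAbscissa (harmonicSum α) ((-(a₁ : ℝ) : ℝ) : EReal) ∧
    ∀ z : ℂ, -(a₁ : ℝ) < z.re →
      Summable (multipleTerm (reversedDual α) z) ∧
      HasNewtonSum (harmonicSum α) z (multipleSeries (reversedDual α) z) := by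
  obtain ⟨L, hL⟩ : ∃ L, (hoffmanDual α).blocks = a₁ :: L := by
    have hlen := (hoffmanDual α).length_pos_of_pos hm
    have ha : a₁ = (hoffmanDual α).blocks[0]'hlen := ha₁
    obtain ⟨b, L, hbL⟩ := List.exists_cons_of_length_pos hlen
    refine ⟨L, ?_⟩
    simp only [hbL, List.getElem_cons_zero] at ha
    rw [hbL, ha]
  have ha0 : 0 < a₁ := (hoffmanDual α).blocks_pos (i := a₁) (by simp [hL])
  have hconv : ∀ z : ℂ, -(a₁ : ℝ) < z.re → Summable (multipleTerm (reversedDual α) z) ∧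
      HasNewtonSum (harmonicSum α) z (multipleSeries (reversedDual α) z) :=
    fun z hz => hasNewtonSum_harmonicSum hm α hL (by linarith)
  refine ⟨⟨fun z hz => ⟨_, (hconv z (EReal.coe_lt_coe_iff.1 hz)).2⟩, ?_⟩, hconv⟩
  rintro z hz - ⟨w, hw⟩
  obtain ⟨x, hzx, hx⟩ := exists_between (EReal.coe_lt_coe_iff.1 hz)
  obtain ⟨b, rfl⟩ : ∃ b, a₁ = b + 1 := ⟨a₁ - 1, by omega⟩
  push_cast at hx
  obtain ⟨M, hM⟩ := newtonPartialSum_bounded hzx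
    (by linarith [(Nat.cast_nonneg b : (0 : ℝ) ≤ b)]) hw
  refine not_bounded_sum_newtonTerm_mul_harmonicSeq hx.le L ⟨M, fun N => ?_⟩
  rw [← hL, ← newtonPartialSum_harmonicSum hm]
  exact hM _
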